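/- Let $E^3$ be $\mathbb R^3$ with the scalar product $\langle x,y\rangle=\epsilon_1x_1y_1+\epsilon_2x_2y_2+\epsilon_3x_3y_3$, where $\epsilon_i=\pm1$, and let $e_1,e_2,e_3$ be the standard basis. Put $\eta_i=\epsilon_3\epsilon_i$ for $i=1,2$ (so $\eta_i=\epsilon_i$ when $\epsilon_3=1$). Let $U\subseteq\mathbb R^2$ be open and connected with $(0,0)\in U$. Call a smooth immersion $X:U\to E^3$ an *$\epsilon$-isothermic Dupin surface with principal curvatures $-\lambda_1,-\lambda_2$* if there is a smooth normal field $N$ with $\langle N,N\rangle=\epsilon_3$ such that $\langle X_{,1},X_{,2}\rangle=0$, $N_{,i}=\lambda_iX_{,i}$, $\lambda_1\ne\lambda_2$ at each point, $\lambda_{i,i}=0$ ($i=1,2$), and the first fundamental form is $I=(\lambda_2-\lambda_1)^{-2}(\epsilon_1du_1^2+\epsilon_2du_2^2)$. Call real functions $h_1,h_2:\mathbb R\to\mathbb R$ *admissible with constants* $b_1,b_2\in\mathbb R$ if $b_2=-(1+b_1)$ and one of the following holds for some real $c_1$ or $c_2$, some real $A_5,A_6,B_7,B_8$ and some complex values of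 the other $A_j,B_j$ (square roots of negative numbers are imaginary): 1. $b_1\ne0$, $1+b_1\ne0$, $h_1=-\frac{\eta_1c_1}{b_1}+A_1e^{\sqrt{b_1\eta_1}u_1}+A_2e^{-\sqrt{b_1\eta_1}u_1}$, $h_2=-\frac{\eta_1c_1}{1+b_1}+A_3e^{\sqrt{-\eta_2(1+b_1)}u_2}+A_4e^{-\sqrt{-\eta_2(1+b_1)}u_2}$, and $c_1^2-4b_1(1+b_1)(b_1A_1A_2-(1+b_1)A_3A_4)=0$; 2. $b_1=0$, $h_1=\frac{c_1}2u_1^2+A_5u_1+A_6$, $h_2=-\eta_1c_1+A_7\cos(\sqrt{\eta_2}u_2)+A_8\sin(\sqrt{\eta_2}u_2)$, and $\eta_1A_5^2-c_1^2-2\eta_1c_1A_6+A_7^2+A_8^2=0$; 3. $b_2\ne0$, $1+b_2\ne0$, $h_1=-\frac{\eta_2c_2}{1+b_2}+B_1e^{\sqrt{-\eta_1(1+b_2)}u_1}+B_2e^{-\sqrt{-\eta_1(1+b_2)}u_1}$, $h_2=-\frac{\eta_2c_2}{b_2}+B_3e^{\sqrt{b_2\eta_2}u_2}+B_4e^{-\sqrt{b_2\eta_2}u_2}$,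 and $c_2^2+4b_2(1+b_2)((1+b_2)B_1B_2-b_2B_3B_4)=0$; 4. $b_2=0$, $h_1=-\eta_2c_2+B_5\cos(\sqrt{\eta_1}u_1)+B_6\sin(\sqrt{\eta_1}u_1)$, $h_2=\frac{c_2}2u_2^2+B_7u_2+B_8$, and $\eta_2B_7^2-c_2^2-2\eta_2c_2B_8+B_5^2+B_6^2=0$. For such data with $h_1(0)\neq h_2(0)$ let $G_1(u_1),G_2(u_2)\in\mathbb R^3$ be the solutions on $\mathbb R$ of $$G_i''-\eta_ib_iG_i=v_i,\qquad G_i(0)=e_3,\quad G_i'(0)=e_i,\qquad(\ast)$$ $$v_1=\frac{\eta_1}{h_2(0)-h_1(0)}\bigl(-\eta_1h_1'(0),\,-\eta_2h_2'(0),\,-h_2(0)-b_1(h_2(0)-h_1(0))\bigr),\qquad v_2=-\eta_1\eta_2v_1.$$ **Theorem.** (a) Let $X$ be an $\epsilon$-isothermic Dupin surface with principal curvatures $-\lambda_1,-\lambda_2$ and normal field $N$ as above, and suppose that $\lambda_1$ or $\lambda_2$ is not constant on $U$. Then there are admissible $h_1,h_2$ with constants $b_1,b_2$ such that $\lambda_1=h_2(u_2)$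 and $\lambda_2=h_1(u_1)$ on $U$, and there is an isometry $x\mapsto Ax+w$ of $E^3$ ($A$ linear) with $AX(0,0)+w=0$, $AX_{,1}(0,0)=\frac{-e_1}{h_1(0)-h_2(0)}$, $AX_{,2}(0,0)=\frac{e_2}{h_1(0)-h_2(0)}$, $AN(0,0)=e_3$, such that on $U$ $$AX+w=\frac{G_2-G_1}{h_1-h_2}$$ with $G_1,G_2$ given by $(\ast)$. In particular $X$ itself is given by this formula if it satisfies these initial conditions with $A=\mathrm{id}$, $w=0$. (b) Conversely, let $h_1,h_2$ be admissible with constants $b_1,b_2$, let $h_1(u_1)\ne h_2(u_2)$ for all $(u_1,u_2)\in U$, and let $G_1,G_2$ be given by $(\ast)$. Then $X=\frac{G_2-G_1}{h_1-h_2}$ is on $U$ an $\epsilon$-isothermic Dupin surface with principal curvatures $-\lambda_1=-h_2(u_2)$ and $-\lambda_2=-h_1(u_1)$. -/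

import Mathlib

open scoped ContDiff

noncomputable section

/-- Pseudo-Euclidean 3-space: `ℝ³` with the scalar product
`⟨x, y⟩ = ε₁ x₁ y₁ + ε₂ x₂ y₂ + ε₃ x₃ y₃`, where each `εᵢ` is `1` or `-1`. -/
def pseudoInner (ε₁ ε₂ ε₃ : ℝ) (x y : Fin 3 → ℝ) : ℝ :=
  ε₁ * x 0 * y 0 + ε₂ * x 1 * y 1 + ε₃ * x 2 * y 2

/-- The partial derivative with respect to the first coordinate. -/
def partial₁ (X : ℝ × ℝ → Fin 3 → ℝ) (p : ℝ × ℝ) : Fin 3 → ℝ := fderiv ℝ X p (1, 0)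

/-- The partial derivative with respect to the second coordinate. -/
def partial₂ (X : ℝ × ℝ → Fin 3 → ℝ) (p : ℝ × ℝ) : Fin 3 → ℝ := fderiv ℝ X p (0, 1)

/-- `X : U → E³` is a smooth immersed surface with unit normal field `N`, `⟨N, N⟩ = ε₃`,
parametrized by lines of curvature, and its principal curvatures `-l₁`, `-l₂` (eigenvalues of
`-dN` in the first and in the second coordinate direction) are distinct at each point. -/
structure IsCurvatureLineSurface (ε₁ ε₂ ε₃ : ℝ) (U : Set (ℝ × ℝ)) (X N : ℝ × ℝ → Fin 3 → ℝ)
    (l₁ l₂ : ℝ × ℝ → ℝ) : Prop where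
  smooth_param : ContDiffOn ℝ ∞ X U
  smooth_normal : ContDiffOn ℝ ∞ N U
  immersion : ∀ p ∈ U, Function.Injective (fderiv ℝ X p)
  normal_unit : ∀ p ∈ U, pseudoInner ε₁ ε₂ ε₃ (N p) (N p) = ε₃
  normal_orth₁ : ∀ p ∈ U, pseudoInner ε₁ ε₂ ε₃ (N p) (partial₁ X p) = 0
  normal_orth₂ : ∀ p ∈ U, pseudoInner ε₁ ε₂ ε₃ (N p) (partial₂ X p) = 0
  orth : ∀ p ∈ U, pseudoInner ε₁ ε₂ ε₃ (partial₁ X p) (partial₂ X p) = 0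
  curvature₁ : ∀ p ∈ U, partial₁ N p = l₁ p • partial₁ X p
  curvature₂ : ∀ p ∈ U, partial₂ N p = l₂ p • partial₂ X p
  distinct : ∀ p ∈ U, l₁ p ≠ l₂ p

/-- A Dupin surface: each principal curvature is constant along its lines of curvature, that is,
`∂lᵢ/∂uᵢ = 0`. -/
structure IsDupinSurface (ε₁ ε₂ ε₃ : ℝ) (U : Set (ℝ × ℝ)) (X N : ℝ × ℝ → Fin 3 → ℝ)
    (l₁ l₂ : ℝ × ℝ → ℝ) : Prop extends IsCurvatureLineSurface ε₁ ε₂ ε₃ U X N l₁ l₂ where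
  dupin₁ : ∀ p ∈ U, HasLineDerivAt ℝ l₁ 0 p (1, 0)
  dupin₂ : ∀ p ∈ U, HasLineDerivAt ℝ l₂ 0 p (0, 1)

/-- An `ε`-isothermic Dupin surface in its `ε`-isothermic curvature line parameters, with first
fundamental form `I = (l₂ - l₁)⁻² (ε₁ du₁² + ε₂ du₂²)`. -/
structure IsIsothermicDupinSurface (ε₁ ε₂ ε₃ : ℝ) (U : Set (ℝ × ℝ)) (X N : ℝ × ℝ → Fin 3 → ℝ)
    (l₁ l₂ : ℝ × ℝ → ℝ) : Prop extends IsDupinSurface ε₁ ε₂ ε₃ U X N l₁ l₂ where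
  metric₁ : ∀ p ∈ U, pseudoInner ε₁ ε₂ ε₃ (partial₁ X p) (partial₁ X p) = ε₁ / (l₂ p - l₁ p) ^ 2
  metric₂ : ∀ p ∈ U, pseudoInner ε₁ ε₂ ε₃ (partial₂ X p) (partial₂ X p) = ε₂ / (l₂ p - l₁ p) ^ 2

/-- Case `b₁ ≠ 0`, `1 + b₁ ≠ 0`. The square roots may be imaginary, so the coefficients of the
exponentials are complex; the functions `h₁`, `h₂` are real. -/
def FamilyExp₁ (η₁ η₂ b₁ : ℝ) (h₁ h₂ : ℝ → ℝ) : Prop :=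
  b₁ ≠ 0 ∧ 1 + b₁ ≠ 0 ∧ ∃ (c₁ : ℝ) (A₁ A₂ A₃ A₄ : ℂ),
    (∀ u : ℝ, (h₁ u : ℂ) = -(η₁ * c₁ / b₁)
      + A₁ * Complex.exp (Complex.sqrt (b₁ * η₁) * u)
      + A₂ * Complex.exp (-(Complex.sqrt (b₁ * η₁) * u))) ∧
    (∀ u : ℝ, (h₂ u : ℂ) = -(η₁ * c₁ / (1 + b₁))
      + A₃ * Complex.exp (Complex.sqrt (-(η₂ * (1 + b₁))) * u)
      + A₄ * Complex.exp (-(Complex.sqrt (-(η₂ * (1 + b₁))) * u))) ∧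
    (c₁ : ℂ) ^ 2 - 4 * b₁ * (1 + b₁) * (b₁ * A₁ * A₂ - (1 + b₁) * A₃ * A₄) = 0

/-- Case `b₁ = 0`. -/
def FamilyQuad₁ (η₁ η₂ b₁ : ℝ) (h₁ h₂ : ℝ → ℝ) : Prop :=
  b₁ = 0 ∧ ∃ (c₁ A₅ A₆ : ℝ) (A₇ A₈ : ℂ),
    (∀ u : ℝ, h₁ u = c₁ / 2 * u ^ 2 + A₅ * u + A₆) ∧
    (∀ u : ℝ, (h₂ u : ℂ) = -(η₁ * c₁)
      + A₇ * Complex.cos (Complex.sqrt η₂ * u) + A₈ * Complex.sin (Complex.sqrt η₂ * u)) ∧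
    (η₁ : ℂ) * A₅ ^ 2 - c₁ ^ 2 - 2 * η₁ * c₁ * A₆ + A₇ ^ 2 + A₈ ^ 2 = 0

/-- Case `b₂ ≠ 0`, `1 + b₂ ≠ 0`. -/
def FamilyExp₂ (η₁ η₂ b₂ : ℝ) (h₁ h₂ : ℝ → ℝ) : Prop :=
  b₂ ≠ 0 ∧ 1 + b₂ ≠ 0 ∧ ∃ (c₂ : ℝ) (B₁ B₂ B₃ B₄ : ℂ),
    (∀ u : ℝ, (h₁ u : ℂ) = -(η₂ * c₂ / (1 + b₂))
      + B₁ * Complex.exp (Complex.sqrt (-(η₁ * (1 + b₂))) * u)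
      + B₂ * Complex.exp (-(Complex.sqrt (-(η₁ * (1 + b₂))) * u))) ∧
    (∀ u : ℝ, (h₂ u : ℂ) = -(η₂ * c₂ / b₂)
      + B₃ * Complex.exp (Complex.sqrt (b₂ * η₂) * u)
      + B₄ * Complex.exp (-(Complex.sqrt (b₂ * η₂) * u))) ∧
    (c₂ : ℂ) ^ 2 + 4 * b₂ * (1 + b₂) * ((1 + b₂) * B₁ * B₂ - b₂ * B₃ * B₄) = 0

/-- Case `b₂ = 0`. -/
def FamilyQuad₂ (η₁ η₂ b₂ : ℝ) (h₁ h₂ : ℝ → ℝ) : Prop :=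
  b₂ = 0 ∧ ∃ (c₂ B₇ B₈ : ℝ) (B₅ B₆ : ℂ),
    (∀ u : ℝ, (h₁ u : ℂ) = -(η₂ * c₂)
      + B₅ * Complex.cos (Complex.sqrt η₁ * u) + B₆ * Complex.sin (Complex.sqrt η₁ * u)) ∧
    (∀ u : ℝ, h₂ u = c₂ / 2 * u ^ 2 + B₇ * u + B₈) ∧
    (η₂ : ℂ) * B₇ ^ 2 - c₂ ^ 2 - 2 * η₂ * c₂ * B₈ + B₅ ^ 2 + B₆ ^ 2 = 0

/-- The explicit functions `h₁`, `h₂`, with their constants `b₁` and `b₂ = -(1 + b₁)`. -/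
def IsCurvatureFamily (η₁ η₂ b₁ b₂ : ℝ) (h₁ h₂ : ℝ → ℝ) : Prop :=
  b₂ = -(1 + b₁) ∧
    (FamilyExp₁ η₁ η₂ b₁ h₁ h₂ ∨ FamilyQuad₁ η₁ η₂ b₁ h₁ h₂ ∨
      FamilyExp₂ η₁ η₂ b₂ h₁ h₂ ∨ FamilyQuad₂ η₁ η₂ b₂ h₁ h₂)

/-- The vector `v₁`. -/
def vecOne (η₁ η₂ b₁ : ℝ) (h₁ h₂ : ℝ → ℝ) : Fin 3 → ℝ :=
  (η₁ / (h₂ 0 - h₁ 0)) •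
    ![-(η₁ * deriv h₁ 0), -(η₂ * deriv h₂ 0), -(h₂ 0) - b₁ * (h₂ 0 - h₁ 0)]

/-- The vector `v₂`. -/
def vecTwo (η₁ η₂ b₁ : ℝ) (h₁ h₂ : ℝ → ℝ) : Fin 3 → ℝ :=
  -((η₁ * η₂) • vecOne η₁ η₂ b₁ h₁ h₂)

/-- `G` is a `C²` solution of `G'' - κ G = v`, `G 0 = x`, `G' 0 = y`. -/
structure SolvesIVP (κ : ℝ) (v x y : Fin 3 → ℝ) (G : ℝ → Fin 3 → ℝ) : Prop where
  contDiff : ContDiff ℝ 2 G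
  ode : ∀ u, deriv (deriv G) u - κ • G u = v
  init : G 0 = x
  init_deriv : deriv G 0 = y

/-- The vector functions `G₁(u₁)`, `G₂(u₂)`. -/
def IsGeneratingPair (η₁ η₂ b₁ b₂ : ℝ) (h₁ h₂ : ℝ → ℝ) (G₁ G₂ : ℝ → Fin 3 → ℝ) : Prop :=
  SolvesIVP (η₁ * b₁) (vecOne η₁ η₂ b₁ h₁ h₂) ![0, 0, 1] ![1, 0, 0] G₁ ∧
  SolvesIVP (η₂ * b₂) (vecTwo η₁ η₂ b₁ h₁ h₂) ![0, 0, 1] ![0, 1, 0] G₂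

/-- `X = (G₂ - G₁) / (h₁ - h₂)`. -/
def dupinParam (h₁ h₂ : ℝ → ℝ) (G₁ G₂ : ℝ → Fin 3 → ℝ) (p : ℝ × ℝ) : Fin 3 → ℝ :=
  (h₁ p.1 - h₂ p.2)⁻¹ • (G₂ p.2 - G₁ p.1)

end

/-!
Write `a = l₂`, `b = l₁`, `f = a - b` and `ηᵢ = ε₃ εᵢ`; lower indices are partial derivatives.

*The curvatures.* With the metric `f⁻² (ε₁ du₁² + ε₂ du₂²)`, and `a₂ = 0`, `b₁ = 0`, the Codazzi
equations hold automatically and the Gauss equation reads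
`f (η₁ a₁₁ - η₂ b₂₂) = η₁ a₁² + η₂ b₂² + a b` (`IsIsothermicDupinSurface.gauss`). Differentiating it
shows that `β = (η₁ a₁₁ + η₂ b₂₂ + b) / f` and then `c = η₁ a₁₁ - β a` have vanishing partial
derivatives. As the domain is connected they are constants, so that `η₁ a₁₁ = β a + c` and
`η₂ b₂₂ = -(1 + β) b - c` (`exists_linear_equations_of_gauss`), while the Gauss equation itself
becomes the vanishing of a first integral. Solving these equations on the whole line gives `h₁` and
`h₂` with `a = h₁(u₁)`, `b = h₂(u₂)`. The equations with their first integral (`IsCurvaturePair`) are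
equivalent to the explicit families (`IsCurvatureFamily`): this is the description of the solutions
by exponentials, trigonometric functions or quadratic polynomials, in which the relation between the
coefficients is the value of the first integral.

*The explicit surfaces.* The spheres of curvature `h₁`, `h₂` touching the surface have Lie
coordinates `Sᵢ = (Gᵢ, hᵢ, qᵢ)` depending on one parameter each, with `Gᵢ = N - hᵢ X` and
`qᵢ = hᵢ ⟨X, X⟩ - 2 ⟨X, N⟩`. They satisfy the same equations `η₁ S₁'' = b₁ S₁ + C` and
`η₂ S₂'' = b₂ S₂ - C`, and for suitable `qᵢ` the initial values and the first integral put all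
products of `Sᵢ`, `Sᵢ'` for the Lie form into equilibrium, so these products are constant
(`exists_isGramData`). The metric of `(G₂ - G₁) / (h₁ - h₂)` and its normal
`(h₁ G₂ - h₂ G₁) / (h₁ - h₂)` follow by algebra (`isIsothermicDupinSurface_dupinParam`).

*Rigidity.* The position vector and the orthonormal frame `-f X₁`, `f X₂`, `N` satisfy a linear total
differential system with coefficients determined by `a` and `b`. By
`eq_zero_of_linear_system` a surface is therefore determined by its curvatures and its frame at one
point. The given surface, moved so that its frame at the origin is the standard basis, and the
explicit one with the same curvatures agree.
-/

/-! ### Second order linear equations with constant coefficients -/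

section LinearODE

variable {E : Type*} [NormedAddCommGroup E] [NormedSpace ℝ E]

/-- `y` solves `y'' = κ y + v` on the whole line, with derivative `y'`. Keeping the derivative as a
separate function makes the equation a first order system. -/
structure IsSolution (κ : ℝ) (v : E) (y y' : ℝ → E) : Prop where
  hasDerivAt : ∀ u, HasDerivAt y (y' u) u
  hasDerivAt' : ∀ u, HasDerivAt y' (κ • y u + v) u

theorem IsSolution.sub {κ : ℝ} {v w : E} {y y' z z' : ℝ → E} (hy : IsSolution κ v y y')
    (hz : IsSolution κ w z z') : IsSolution κ (v - w) (y - z) (y' - z') where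
  hasDerivAt u := (hy.hasDerivAt u).sub (hz.hasDerivAt u)
  hasDerivAt' u := by
    convert (hy.hasDerivAt' u).sub (hz.hasDerivAt' u) using 1
    simp only [Pi.sub_apply, smul_sub]
    abel

theorem IsSolution.clm {F : Type*} [NormedAddCommGroup F] [NormedSpace ℝ F] {κ : ℝ} {v : E}
    {y y' : ℝ → E} (hy : IsSolution κ v y y') (L : E →L[ℝ] F) :
    IsSolution κ (L v) (fun u => L (y u)) (fun u => L (y' u)) where
  hasDerivAt u := L.hasFDerivAt.comp_hasDerivAt u (hy.hasDerivAt u)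
  hasDerivAt' u := by
    have := L.hasFDerivAt.comp_hasDerivAt u (hy.hasDerivAt' u)
    rw [map_add, map_smul] at this
    exact this

theorem IsSolution.prodMk {F : Type*} [NormedAddCommGroup F] [NormedSpace ℝ F] {κ : ℝ} {v : E}
    {w : F} {y y' : ℝ → E} {z z' : ℝ → F} (hy : IsSolution κ v y y') (hz : IsSolution κ w z z') :
    IsSolution κ (v, w) (fun u => (y u, z u)) (fun u => (y' u, z' u)) where
  hasDerivAt u := (hy.hasDerivAt u).prodMk (hz.hasDerivAt u)
  hasDerivAt' u := (hy.hasDerivAt' u).prodMk (hz.hasDerivAt' u)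

theorem IsSolution.pi {ι : Type*} [Fintype ι] {κ : ℝ} {v : ι → ℝ} {y y' : ι → ℝ → ℝ}
    (h : ∀ i, IsSolution κ (v i) (y i) (y' i)) :
    IsSolution κ v (fun u i => y i u) (fun u i => y' i u) where
  hasDerivAt u := hasDerivAt_pi.2 fun i => (h i).hasDerivAt u
  hasDerivAt' u := hasDerivAt_pi.2 fun i => (h i).hasDerivAt' u

theorem IsSolution.eq_zero {κ : ℝ} {y y' : ℝ → E} (hy : IsSolution κ 0 y y') (h0 : y 0 = 0)
    (h0' : y' 0 = 0) : y = 0 ∧ y' = 0 := by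
  let L : E × E →L[ℝ] E × E :=
    (ContinuousLinearMap.snd ℝ E E).prod (κ • ContinuousLinearMap.fst ℝ E E)
  have key : (fun u => (y u, y' u)) = fun _ => (0 : E × E) := by
    refine ODE_solution_unique_univ (v := fun _ => L) (s := fun _ => Set.univ) (K := ‖L‖₊) (t₀ := 0)
      (fun t => L.lipschitz.lipschitzOnWith) (fun t => ⟨?_, trivial⟩) (fun t => ⟨?_, trivial⟩) ?_
    · simpa [L] using (hy.hasDerivAt t).prodMk (hy.hasDerivAt' t)
    · simpa using hasDerivAt_const t (0 : E × E)
    · simp [h0, h0']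
  exact ⟨funext fun u => (Prod.ext_iff.1 (congrFun key u)).1,
    funext fun u => (Prod.ext_iff.1 (congrFun key u)).2⟩

theorem IsSolution.unique {κ : ℝ} {v : E} {y y' z z' : ℝ → E} (hy : IsSolution κ v y y')
    (hz : IsSolution κ v z z') (h0 : y 0 = z 0) (h0' : y' 0 = z' 0) : y = z ∧ y' = z' := by
  have h := hy.sub hz
  rw [sub_self] at h
  have := h.eq_zero (by simp [h0]) (by simp [h0'])
  exact ⟨sub_eq_zero.1 this.1, sub_eq_zero.1 this.2⟩

/-- A solution that starts at rest in an equilibrium stays there. -/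
theorem IsSolution.eq_const {κ : ℝ} {v : E} {y y' : ℝ → E} (hy : IsSolution κ v y y')
    (h0 : κ • y 0 + v = 0) (h0' : y' 0 = 0) (u : ℝ) : y u = y 0 ∧ y' u = 0 := by
  have hc : IsSolution κ v (fun _ => y 0) (fun _ => 0) :=
    ⟨fun u => hasDerivAt_const u _, fun u => by simpa [h0] using hasDerivAt_const u (0 : E)⟩
  have := hy.unique hc rfl h0'
  exact ⟨congrFun this.1 u, congrFun this.2 u⟩

theorem IsSolution.contDiff {κ : ℝ} {v : E} {y y' : ℝ → E} (hy : IsSolution κ v y y') :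
    ContDiff ℝ ∞ y ∧ ContDiff ℝ ∞ y' := by
  have hd : deriv y = y' := funext fun u => (hy.hasDerivAt u).deriv
  have hd' : deriv y' = fun u => κ • y u + v := funext fun u => (hy.hasDerivAt' u).deriv
  have key : ∀ n : ℕ, ContDiff ℝ n y ∧ ContDiff ℝ n y' := by
    intro n
    induction n with
    | zero =>
      simp only [CharP.cast_eq_zero, contDiff_zero]
      exact ⟨continuous_iff_continuousAt.2 fun u => (hy.hasDerivAt u).continuousAt,
        continuous_iff_continuousAt.2 fun u => (hy.hasDerivAt' u).continuousAt⟩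
    | succ n ih =>
      push_cast
      rw [contDiff_succ_iff_deriv, contDiff_succ_iff_deriv, hd, hd']
      refine ⟨⟨fun u => (hy.hasDerivAt u).differentiableAt, by simp, ih.2⟩,
        fun u => (hy.hasDerivAt' u).differentiableAt, by simp, ?_⟩
      exact (ih.1.const_smul κ).add contDiff_const
  exact ⟨contDiff_infty.2 fun n => (key n).1, contDiff_infty.2 fun n => (key n).2⟩

theorem isSolution_exp (s p A B : ℂ) (κ v : ℝ) (hs : s ^ 2 = κ) (hp : κ * p + v = 0) :
    IsSolution κ (v : ℂ)
      (fun u : ℝ => p + A * Complex.exp (s * u) + B * Complex.exp (-(s * u)))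
      (fun u : ℝ => A * s * Complex.exp (s * u) - B * s * Complex.exp (-(s * u))) := by
  have h : ∀ u : ℝ, HasDerivAt (fun u : ℝ => s * (u : ℂ)) s u := fun u => by
    simpa using (Complex.ofRealCLM.hasDerivAt (x := u)).const_mul s
  constructor <;> intro u
  · convert (((h u).cexp.const_mul A).const_add p).fun_add ((h u).fun_neg.cexp.const_mul B) using 1
    ring
  · convert ((h u).cexp.const_mul (A * s)).fun_sub ((h u).fun_neg.cexp.const_mul (B * s)) using 1
    rw [Complex.real_smul]
    linear_combination hp
      - (A * Complex.exp (s * u) + B * Complex.exp (-(s * u))) * hs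

theorem isSolution_trig (s p A B : ℂ) (κ v : ℝ) (hs : s ^ 2 = -κ) (hp : κ * p + v = 0) :
    IsSolution κ (v : ℂ)
      (fun u : ℝ => p + A * Complex.cos (s * u) + B * Complex.sin (s * u))
      (fun u : ℝ => B * s * Complex.cos (s * u) - A * s * Complex.sin (s * u)) := by
  have h : ∀ u : ℝ, HasDerivAt (fun u : ℝ => s * (u : ℂ)) s u := fun u => by
    simpa using (Complex.ofRealCLM.hasDerivAt (x := u)).const_mul s
  have hc := fun u : ℝ => show HasDerivAt (fun u : ℝ => Complex.cos (s * u))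
    (s • -Complex.sin (s * u)) u from
      HasDerivAt.scomp (g₁ := Complex.cos) (h := fun u : ℝ => s * (u : ℂ)) u
        (Complex.hasDerivAt_cos _) (h u)
  have hsin := fun u : ℝ => show HasDerivAt (fun u : ℝ => Complex.sin (s * u))
    (s • Complex.cos (s * u)) u from
      HasDerivAt.scomp (g₁ := Complex.sin) (h := fun u : ℝ => s * (u : ℂ)) u
        (Complex.hasDerivAt_sin _) (h u)
  constructor <;> intro u
  · convert (((hc u).const_mul A).const_add p).fun_add ((hsin u).const_mul B) using 1
    simp only [smul_eq_mul]
    ring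
  · convert ((hc u).const_mul (B * s)).fun_sub ((hsin u).const_mul (A * s)) using 1
    rw [Complex.real_smul]
    simp only [smul_eq_mul]
    linear_combination hp
      + (A * Complex.cos (s * u) + B * Complex.sin (s * u)) * hs

theorem isSolution_quadratic (v x y : ℝ) :
    IsSolution 0 v (fun u => v / 2 * u ^ 2 + y * u + x) (fun u => v * u + y) := by
  constructor <;> intro u
  · refine ((((hasDerivAt_pow 2 u).const_mul (v / 2)).fun_add
      ((hasDerivAt_id u).const_mul y)).add_const x).congr_deriv ?_
    push_cast
    ring
  · refine (((hasDerivAt_id u).const_mul v).add_const y).congr_deriv ?_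
    rw [zero_smul, zero_add, mul_one]

/-- A complex solution with real coefficients that takes real values is a real solution. -/
theorem IsSolution.of_ofReal {κ v : ℝ} {h : ℝ → ℝ} {F F' : ℝ → ℂ}
    (hF : IsSolution κ (v : ℂ) F F') (hh : ∀ u, (h u : ℂ) = F u) :
    ∃ h', IsSolution κ v h h' ∧ ∀ u, (h' u : ℂ) = F' u := by
  have h1 := hF.clm Complex.reCLM
  have hre : (fun u => Complex.reCLM (F u)) = h := by
    funext u
    simp [← hh u]
  rw [hre] at h1
  refine ⟨fun u => Complex.reCLM (F' u), by simpa using h1, fun u => ?_⟩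
  have h2 : HasDerivAt F ((Complex.reCLM (F' u) : ℝ) : ℂ) u := by
    rw [show F = fun u => (h u : ℂ) from funext fun u => (hh u).symm]
    exact (h1.hasDerivAt u).ofReal_comp
  exact h2.unique (hF.hasDerivAt u)

theorem IsSolution.ofReal {κ v : ℝ} {h h' : ℝ → ℝ} (hh : IsSolution κ v h h') :
    IsSolution κ (v : ℂ) (fun u => (h u : ℂ)) (fun u => (h' u : ℂ)) :=
  hh.clm Complex.ofRealCLM

/-- A real solution is a combination of exponentials, with complex coefficients where `κ < 0`. -/
theorem IsSolution.exists_exp {κ v : ℝ} {h h' : ℝ → ℝ} (hh : IsSolution κ v h h')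
    {s p : ℂ} (hκ : κ ≠ 0) (hs : s ^ 2 = κ) (hp : κ * p + v = 0) :
    ∃ A B : ℂ, (∀ u : ℝ, (h u : ℂ) = p + A * Complex.exp (s * u) + B * Complex.exp (-(s * u))) ∧
      (h 0 : ℂ) = p + A + B ∧ (h' 0 : ℂ) = s * (A - B) := by
  have hs0 : s ≠ 0 := by
    rintro rfl
    apply hκ
    exact_mod_cast (by simpa using hs.symm : (κ : ℂ) = 0)
  have e1 : (h 0 : ℂ) = p + ((h 0 - p) + h' 0 / s) / 2 + ((h 0 - p) - h' 0 / s) / 2 := by ring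
  have e2 : (h' 0 : ℂ) = s * (((h 0 - p) + h' 0 / s) / 2 - ((h 0 - p) - h' 0 / s) / 2) := by
    field_simp
    ring
  refine ⟨((h 0 - p) + h' 0 / s) / 2, ((h 0 - p) - h' 0 / s) / 2, fun u => ?_, e1, e2⟩
  refine congrFun (hh.ofReal.unique (isSolution_exp s p _ _ κ v hs hp) ?_ ?_).1 u
  · simpa using e1
  · simp only [Complex.ofReal_zero, mul_zero, neg_zero, Complex.exp_zero, mul_one]
    linear_combination e2

theorem IsSolution.exists_trig {κ v : ℝ} {h h' : ℝ → ℝ} (hh : IsSolution κ v h h')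
    {s p : ℂ} (hκ : κ ≠ 0) (hs : s ^ 2 = -κ) (hp : κ * p + v = 0) :
    ∃ A B : ℂ, (∀ u : ℝ, (h u : ℂ) = p + A * Complex.cos (s * u) + B * Complex.sin (s * u)) ∧
      (h 0 : ℂ) = p + A ∧ (h' 0 : ℂ) = s * B := by
  have hs0 : s ≠ 0 := by
    rintro rfl
    apply hκ
    exact_mod_cast (by simpa using hs.symm : (κ : ℂ) = 0)
  have e2 : (h' 0 : ℂ) = s * (h' 0 / s) := by field_simp
  refine ⟨h 0 - p, h' 0 / s, fun u => ?_, by ring, e2⟩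
  refine congrFun (hh.ofReal.unique (isSolution_trig s p _ _ κ v hs hp) ?_ ?_).1 u
  · simp
  · simp only [Complex.ofReal_zero, mul_zero, Complex.cos_zero, Complex.sin_zero, mul_one,
      sub_zero]
    linear_combination e2

theorem exists_isSolution (κ v x y : ℝ) :
    ∃ h h' : ℝ → ℝ, IsSolution κ v h h' ∧ h 0 = x ∧ h' 0 = y := by
  by_cases hκ : κ = 0
  · subst hκ
    exact ⟨_, _, isSolution_quadratic v x y, by simp, by simp⟩
  · obtain ⟨s, hs⟩ : ∃ s : ℂ, s ^ 2 = κ := IsAlgClosed.exists_pow_nat_eq _ two_pos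
    have hκ' : (κ : ℂ) ≠ 0 := by exact_mod_cast hκ
    have hs0 : s ≠ 0 := by
      rintro rfl
      exact hκ' (by simpa using hs.symm)
    have h1 := (isSolution_exp s (-(v / κ)) ((x + v / κ + y / s) / 2) ((x + v / κ - y / s) / 2)
      κ v hs (by field_simp; ring)).clm Complex.reCLM
    refine ⟨_, _, by simpa using h1, ?_, ?_⟩
    · rw [← Complex.ofReal_re x]
      simp
      ring
    · have : (x + v / κ + y / s) / 2 * s - (x + v / κ - y / s) / 2 * s = (y : ℂ) := by
        field_simp
        ring
      simpa using congrArg Complex.re this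

theorem exists_isSolution_pi {ι : Type*} [Fintype ι] (κ : ℝ) (v x y : ι → ℝ) :
    ∃ G G' : ℝ → ι → ℝ, IsSolution κ v G G' ∧ G 0 = x ∧ G' 0 = y := by
  choose g g' hg h0 h0' using fun i => exists_isSolution κ (v i) (x i) (y i)
  exact ⟨_, _, IsSolution.pi hg, funext h0, funext h0'⟩

end LinearODE

/-! ### Linear total differential systems in the plane -/

section TotalDifferential

variable {E : Type*} [NormedAddCommGroup E] [NormedSpace ℝ E]

/-- A solution of a linear total differential system `∂₁Y = P Y`, `∂₂Y = Q Y` on a connected open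
set is zero if it vanishes at one point: by Grönwall's inequality along segments, its zero set is
open, and it is closed by continuity. -/
theorem eq_zero_of_linear_system {n : ℕ} {U : Set (ℝ × ℝ)} (hU : IsOpen U) (hUc : IsPreconnected U)
    {Y : Fin n → ℝ × ℝ → E} {P Q : ℝ × ℝ → Fin n → Fin n → ℝ}
    (hY : ∀ i, ∀ p ∈ U, DifferentiableAt ℝ (Y i) p)
    (hP : ContinuousOn P U) (hQ : ContinuousOn Q U)
    (h1 : ∀ i, ∀ p ∈ U, fderiv ℝ (Y i) p (1, 0) = ∑ j, P p i j • Y j p)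
    (h2 : ∀ i, ∀ p ∈ U, fderiv ℝ (Y i) p (0, 1) = ∑ j, Q p i j • Y j p)
    {p₀ : ℝ × ℝ} (hp₀ : p₀ ∈ U) (h0 : ∀ i, Y i p₀ = 0) :
    ∀ p ∈ U, ∀ i, Y i p = 0 := by
  let Z : ℝ × ℝ → Fin n → E := fun p i => Y i p
  have hZc : ContinuousOn Z U := continuousOn_pi.2 fun i p hp =>
    (hY i p hp).continuousAt.continuousWithinAt
  have hopen : ∀ p ∈ U, Z p = 0 → ∀ᶠ q in nhds p, Z q = 0 := by
    intro p hp hZp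
    -- a ball on which both coefficient matrices are bounded
    obtain ⟨K, r, hr, hball, hK⟩ : ∃ K r : ℝ, 0 < r ∧ Metric.ball p r ⊆ U ∧
        ∀ q ∈ Metric.ball p r, ‖P q‖ ≤ K ∧ ‖Q q‖ ≤ K := by
      have e1 : ∀ᶠ q in nhds p, ‖P q‖ < ‖P p‖ + 1 :=
        (hP.continuousAt (hU.mem_nhds hp)).norm.eventually_lt continuousAt_const (by simp)
      have e2 : ∀ᶠ q in nhds p, ‖Q q‖ < ‖Q p‖ + 1 :=
        (hQ.continuousAt (hU.mem_nhds hp)).norm.eventually_lt continuousAt_const (by simp)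
      obtain ⟨r, hr, h⟩ := Metric.eventually_nhds_iff_ball.1 (e1.and (e2.and (hU.mem_nhds hp)))
      refine ⟨max (‖P p‖ + 1) (‖Q p‖ + 1), r, hr, fun q hq => (h q hq).2.2, fun q hq => ⟨?_, ?_⟩⟩
      · exact (h q hq).1.le.trans (le_max_left _ _)
      · exact (h q hq).2.1.le.trans (le_max_right _ _)
    filter_upwards [Metric.ball_mem_nhds p hr] with q hq
    let γ : ℝ → ℝ × ℝ := fun t => p + t • (q - p)
    have hγ : ∀ t, HasDerivAt γ (q - p) t := fun t => by
      simpa [γ] using ((hasDerivAt_id t).smul_const (q - p)).const_add p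
    have hγU : ∀ t ∈ Set.Icc (0 : ℝ) 1, γ t ∈ Metric.ball p r := fun t ht =>
      (convex_ball p r).add_smul_sub_mem (Metric.mem_ball_self hr) hq ht
    have hd : ∀ t ∈ Set.Icc (0 : ℝ) 1, HasDerivAt (Z ∘ γ)
        (fun i => fderiv ℝ (Y i) (γ t) (q - p)) t := by
      intro t ht
      refine hasDerivAt_pi.2 fun i => ?_
      exact (hY i _ (hball (hγU t ht))).hasFDerivAt.comp_hasDerivAt t (hγ t)
    have hsum : ∀ (M : Fin n → Fin n → ℝ) (z : Fin n → E) (i : Fin n), ‖M‖ ≤ K →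
        ‖∑ j, M i j • z j‖ ≤ n * K * ‖z‖ := by
      intro M z i hM
      calc ‖∑ j, M i j • z j‖ ≤ ∑ _j : Fin n, K * ‖z‖ := by
            refine norm_sum_le_of_le _ fun j _ => ?_
            rw [norm_smul]
            have : ‖M i j‖ ≤ K := ((norm_le_pi_norm (M i) j).trans (norm_le_pi_norm M i)).trans hM
            exact mul_le_mul this (norm_le_pi_norm z j) (norm_nonneg _)
              ((norm_nonneg _).trans this)
        _ = n * K * ‖z‖ := by simp [mul_assoc]
    have hbound : ∀ t ∈ Set.Ico (0 : ℝ) 1, ‖fun i => fderiv ℝ (Y i) (γ t) (q - p)‖ ≤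
        (|(q - p).1| + |(q - p).2|) * (n * K) * ‖(Z ∘ γ) t‖ := by
      intro t ht
      have hb := hγU t ⟨ht.1, ht.2.le⟩
      have hK0 : 0 ≤ K := (norm_nonneg _).trans (hK _ hb).1
      refine (pi_norm_le_iff_of_nonneg (by positivity)).2 fun i => ?_
      have hqp : q - p = (q - p).1 • ((1 : ℝ), (0 : ℝ)) + (q - p).2 • ((0 : ℝ), (1 : ℝ)) := by
        ext <;> simp
      rw [hqp, map_add, map_smul, map_smul, h1 i _ (hball hb), h2 i _ (hball hb), ← hqp]
      refine (norm_add_le _ _).trans ?_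
      rw [norm_smul, norm_smul, Real.norm_eq_abs, Real.norm_eq_abs, add_mul, add_mul,
        mul_assoc |(q - p).1|, mul_assoc |(q - p).2|]
      exact add_le_add (mul_le_mul_of_nonneg_left (hsum _ (Z (γ t)) i (hK _ hb).1) (abs_nonneg _))
        (mul_le_mul_of_nonneg_left (hsum _ (Z (γ t)) i (hK _ hb).2) (abs_nonneg _))
    have := norm_le_gronwallBound_of_norm_deriv_right_le (f := Z ∘ γ) (δ := 0) (ε := 0)
      (fun t ht => (hd t ht).continuousAt.continuousWithinAt)
      (fun t ht => (hd t ⟨ht.1, ht.2.le⟩).hasDerivWithinAt) (by simp [γ, hZp])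
      (fun t ht => by simpa using hbound t ht) 1 (by simp)
    simpa [gronwallBound_ε0_δ0, γ] using this
  have hsub : U ⊆ interior {p | Z p = 0} := by
    refine hUc.subset_of_closure_inter_subset isOpen_interior
      ⟨p₀, hp₀, mem_interior_iff_mem_nhds.2 (hopen p₀ hp₀ (funext h0))⟩ ?_
    rintro p ⟨hpc, hp⟩
    refine mem_interior_iff_mem_nhds.2 (hopen p hp ?_)
    have hcl : p ∈ closure {p | Z p = 0} := closure_mono interior_subset hpc
    exact closure_minimal (s := Z '' {p | Z p = 0}) (t := {0})
      (by rintro _ ⟨q, hq, rfl⟩; exact hq) isClosed_singleton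
      (hZc.continuousAt (hU.mem_nhds hp) |>.continuousWithinAt.mem_closure_image hcl)
  intro p hp i
  have : p ∈ {p | Z p = 0} := interior_subset (hsub hp)
  exact congrFun this i

end TotalDifferential

/-! ### The principal curvatures as solutions of linear equations -/

/-- The principal curvatures of an `ε`-isothermic Dupin surface, described by equations instead of
formulas: `η₁h₁'' = b h₁ + c` and `η₂h₂'' = -(1 + b) h₂ - c`, together with the vanishing of the sum
of their first integrals. The latter is constant, so it is required at the origin only. -/
structure IsCurvaturePair (η₁ η₂ b c : ℝ) (h₁ h₁' h₂ h₂' : ℝ → ℝ) : Prop where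
  sol₁ : IsSolution (η₁ * b) (η₁ * c) h₁ h₁'
  sol₂ : IsSolution (η₂ * -(1 + b)) (-(η₂ * c)) h₂ h₂'
  first_integral : b * h₁ 0 ^ 2 + 2 * c * h₁ 0 - (1 + b) * h₂ 0 ^ 2 - 2 * c * h₂ 0
    = η₁ * h₁' 0 ^ 2 + η₂ * h₂' 0 ^ 2

theorem Complex.sqrt_sq_eq (z : ℂ) : Complex.sqrt z ^ 2 = z := by
  have h := Complex.cpow_nat_inv_pow z two_ne_zero
  rw [Nat.cast_ofNat] at h
  exact h

/-- For exponential solutions, the relation between the coefficients is the vanishing of the first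
integral, up to the factor `-b (1 + b)`. -/
theorem first_integral_exp {η₁ η₂ b c : ℂ} (hη₁ : η₁ ^ 2 = 1) (hη₂ : η₂ ^ 2 = 1) (hb : b ≠ 0)
    (hb' : 1 + b ≠ 0) {s t A₁ A₂ A₃ A₄ x x' y y' : ℂ} (hs : s ^ 2 = η₁ * b)
    (ht : t ^ 2 = η₂ * -(1 + b)) (hx : x = -(c / b) + A₁ + A₂) (hx' : x' = s * (A₁ - A₂))
    (hy : y = -(c / (1 + b)) + A₃ + A₄) (hy' : y' = t * (A₃ - A₄)) :
    b * x ^ 2 + 2 * c * x - (1 + b) * y ^ 2 - 2 * c * y = η₁ * x' ^ 2 + η₂ * y' ^ 2 ↔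
      c ^ 2 - 4 * b * (1 + b) * (b * A₁ * A₂ - (1 + b) * A₃ * A₄) = 0 := by
  have key : b * (1 + b) * (b * x ^ 2 + 2 * c * x - (1 + b) * y ^ 2 - 2 * c * y
      - (η₁ * x' ^ 2 + η₂ * y' ^ 2))
      = -(c ^ 2 - 4 * b * (1 + b) * (b * A₁ * A₂ - (1 + b) * A₃ * A₄)) := by
    have e1 : η₁ * x' ^ 2 = b * (A₁ - A₂) ^ 2 := by
      rw [hx']
      linear_combination η₁ * (A₁ - A₂) ^ 2 * hs + b * (A₁ - A₂) ^ 2 * hη₁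
    have e2 : η₂ * y' ^ 2 = -(1 + b) * (A₃ - A₄) ^ 2 := by
      rw [hy']
      linear_combination η₂ * (A₃ - A₄) ^ 2 * ht - (1 + b) * (A₃ - A₄) ^ 2 * hη₂
    rw [e1, e2, hx, hy]
    field_simp
    ring
  rw [← sub_eq_zero, ← mul_eq_zero_iff_left (mul_ne_zero hb hb'), key, neg_eq_zero]

theorem first_integral_trig {η₁ η₂ c A₅ A₆ A₇ A₈ t y y' : ℂ} (hη₁ : η₁ ^ 2 = 1) (hη₂ : η₂ ^ 2 = 1)
    (ht : t ^ 2 = η₂) (hy : y = -(η₁ * c) + A₇) (hy' : y' = t * A₈) :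
    2 * (η₁ * c) * A₆ - y ^ 2 - 2 * (η₁ * c) * y = η₁ * A₅ ^ 2 + η₂ * y' ^ 2 ↔
      η₁ * A₅ ^ 2 - c ^ 2 - 2 * η₁ * c * A₆ + A₇ ^ 2 + A₈ ^ 2 = 0 := by
  have key : η₁ * A₅ ^ 2 + η₂ * y' ^ 2 - (2 * (η₁ * c) * A₆ - y ^ 2 - 2 * (η₁ * c) * y)
      = η₁ * A₅ ^ 2 - c ^ 2 - 2 * η₁ * c * A₆ + A₇ ^ 2 + A₈ ^ 2 := by
    rw [hy, hy']
    linear_combination η₂ * A₈ ^ 2 * ht + A₈ ^ 2 * hη₂ - c ^ 2 * hη₁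
  rw [← key, sub_eq_zero, eq_comm]

theorem FamilyExp₁.exists_isCurvaturePair {η₁ η₂ b : ℝ} (hη₁ : η₁ ^ 2 = 1) (hη₂ : η₂ ^ 2 = 1)
    {h₁ h₂ : ℝ → ℝ} (h : FamilyExp₁ η₁ η₂ b h₁ h₂) :
    ∃ c h₁' h₂', IsCurvaturePair η₁ η₂ b c h₁ h₁' h₂ h₂' := by
  obtain ⟨hb, hb', c, A₁, A₂, A₃, A₄, e1, e2, hA⟩ := h
  have hη₁' : (η₁ : ℂ) ^ 2 = 1 := by exact_mod_cast hη₁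
  have hη₂' : (η₂ : ℂ) ^ 2 = 1 := by exact_mod_cast hη₂
  have hbC : (b : ℂ) ≠ 0 := by exact_mod_cast hb
  have hbC' : 1 + (b : ℂ) ≠ 0 := by exact_mod_cast hb'
  have hs : Complex.sqrt (b * η₁) ^ 2 = ((η₁ * b : ℝ) : ℂ) := by
    rw [Complex.sqrt_sq_eq]; push_cast; ring
  have ht : Complex.sqrt (-(η₂ * (1 + b))) ^ 2 = ((η₂ * -(1 + b) : ℝ) : ℂ) := by
    rw [Complex.sqrt_sq_eq]; push_cast; ring
  obtain ⟨h₁', s1, d1⟩ := (isSolution_exp _ (-(η₁ * c / b)) A₁ A₂ (η₁ * b) (η₁ * (η₁ * c)) hs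
    (by push_cast; field_simp; ring)).of_ofReal e1
  obtain ⟨h₂', s2, d2⟩ := (isSolution_exp _ (-(η₁ * c / (1 + b))) A₃ A₄ (η₂ * -(1 + b))
    (-(η₂ * (η₁ * c))) ht (by push_cast; field_simp; ring)).of_ofReal e2
  refine ⟨η₁ * c, h₁', h₂', s1, s2, ?_⟩
  have := (first_integral_exp (c := η₁ * c) (A₁ := A₁) (A₂ := A₂) (A₃ := A₃) (A₄ := A₄)
    hη₁' hη₂' hbC hbC' (by simpa using hs)
    (by simpa using ht) (x := h₁ 0) (x' := h₁' 0) (y := h₂ 0) (y' := h₂' 0) (by simp [e1])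
    (by rw [d1]; simp; ring) (by simp [e2]) (by rw [d2]; simp; ring)).2
    (by linear_combination hA + (c : ℂ) ^ 2 * hη₁')
  exact_mod_cast this

theorem FamilyQuad₁.exists_isCurvaturePair {η₁ η₂ b : ℝ} (hη₁ : η₁ ^ 2 = 1) (hη₂ : η₂ ^ 2 = 1)
    {h₁ h₂ : ℝ → ℝ} (h : FamilyQuad₁ η₁ η₂ b h₁ h₂) :
    ∃ c h₁' h₂', IsCurvaturePair η₁ η₂ b c h₁ h₁' h₂ h₂' := by
  obtain ⟨rfl, c, A₅, A₆, A₇, A₈, e1, e2, hA⟩ := h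
  have hη₁' : (η₁ : ℂ) ^ 2 = 1 := by exact_mod_cast hη₁
  have hη₂' : (η₂ : ℂ) ^ 2 = 1 := by exact_mod_cast hη₂
  have ht : Complex.sqrt η₂ ^ 2 = -((η₂ * -(1 + 0) : ℝ) : ℂ) := by
    rw [Complex.sqrt_sq_eq]; push_cast; ring
  have s1 : IsSolution (η₁ * 0) (η₁ * (η₁ * c)) h₁ (fun u => c * u + A₅) := by
    rw [mul_zero, ← mul_assoc, ← sq, hη₁, one_mul, funext e1]
    exact isSolution_quadratic c A₆ A₅
  obtain ⟨h₂', s2, d2⟩ := (isSolution_trig _ (-(η₁ * c)) A₇ A₈ (η₂ * -(1 + 0))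
    (-(η₂ * (η₁ * c))) ht (by push_cast; ring)).of_ofReal e2
  refine ⟨η₁ * c, _, h₂', s1, s2, ?_⟩
  have := (first_integral_trig (c := c) (A₅ := A₅) (A₆ := h₁ 0) (A₇ := A₇) (A₈ := A₈)
    hη₁' hη₂' (by simpa using ht) (y := h₂ 0)
    (y' := h₂' 0) (by simp [e2]) (by simp [d2]; ring)).2 (by simpa [e1] using hA)
  have : 2 * (η₁ * c) * h₁ 0 - h₂ 0 ^ 2 - 2 * (η₁ * c) * h₂ 0 = η₁ * A₅ ^ 2 + η₂ * h₂' 0 ^ 2 := by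
    exact_mod_cast this
  linear_combination this

/-- Exchanging the two coordinates exchanges `b` with `-(1 + b)` and changes the sign of `c`. -/
theorem IsCurvaturePair.swap {η₁ η₂ b c : ℝ} {h₁ h₁' h₂ h₂' : ℝ → ℝ}
    (h : IsCurvaturePair η₁ η₂ b c h₁ h₁' h₂ h₂') :
    IsCurvaturePair η₂ η₁ (-(1 + b)) (-c) h₂ h₂' h₁ h₁' where
  sol₁ := by simpa using h.sol₂
  sol₂ := by simpa using h.sol₁
  first_integral := by linear_combination h.first_integral

theorem FamilyExp₂.exists_isCurvaturePair {η₁ η₂ b : ℝ} (hη₁ : η₁ ^ 2 = 1) (hη₂ : η₂ ^ 2 = 1)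
    {h₁ h₂ : ℝ → ℝ} (h : FamilyExp₂ η₁ η₂ (-(1 + b)) h₁ h₂) :
    ∃ c h₁' h₂', IsCurvaturePair η₁ η₂ b c h₁ h₁' h₂ h₂' := by
  obtain ⟨hb, hb', c, B₁, B₂, B₃, B₄, e1, e2, hB⟩ := h
  have hswap : FamilyExp₁ η₂ η₁ (-(1 + b)) h₂ h₁ :=
    ⟨hb, hb', c, B₃, B₄, B₁, B₂, e2, e1, by linear_combination hB⟩
  obtain ⟨c', h₂', h₁', H⟩ := hswap.exists_isCurvaturePair hη₂ hη₁
  exact ⟨-c', h₁', h₂', by simpa using H.swap⟩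

theorem FamilyQuad₂.exists_isCurvaturePair {η₁ η₂ b : ℝ} (hη₁ : η₁ ^ 2 = 1) (hη₂ : η₂ ^ 2 = 1)
    {h₁ h₂ : ℝ → ℝ} (h : FamilyQuad₂ η₁ η₂ (-(1 + b)) h₁ h₂) :
    ∃ c h₁' h₂', IsCurvaturePair η₁ η₂ b c h₁ h₁' h₂ h₂' := by
  obtain ⟨hb, c, B₇, B₈, B₅, B₆, e1, e2, hB⟩ := h
  have hswap : FamilyQuad₁ η₂ η₁ (-(1 + b)) h₂ h₁ :=
    ⟨hb, c, B₇, B₈, B₅, B₆, e2, e1, hB⟩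
  obtain ⟨c', h₂', h₁', H⟩ := hswap.exists_isCurvaturePair hη₂ hη₁
  exact ⟨-c', h₁', h₂', by simpa using H.swap⟩

theorem IsCurvatureFamily.exists_isCurvaturePair {η₁ η₂ b₁ b₂ : ℝ} (hη₁ : η₁ ^ 2 = 1)
    (hη₂ : η₂ ^ 2 = 1) {h₁ h₂ : ℝ → ℝ} (h : IsCurvatureFamily η₁ η₂ b₁ b₂ h₁ h₂) :
    ∃ c h₁' h₂', IsCurvaturePair η₁ η₂ b₁ c h₁ h₁' h₂ h₂' := by
  obtain ⟨rfl, h | h | h | h⟩ := h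
  · exact h.exists_isCurvaturePair hη₁ hη₂
  · exact h.exists_isCurvaturePair hη₁ hη₂
  · exact h.exists_isCurvaturePair hη₁ hη₂
  · exact h.exists_isCurvaturePair hη₁ hη₂

theorem IsCurvaturePair.familyExp₁ {η₁ η₂ b c : ℝ} {h₁ h₁' h₂ h₂' : ℝ → ℝ} (hη₁ : η₁ ^ 2 = 1)
    (hη₂ : η₂ ^ 2 = 1) (h : IsCurvaturePair η₁ η₂ b c h₁ h₁' h₂ h₂') (hb : b ≠ 0)
    (hb' : 1 + b ≠ 0) : FamilyExp₁ η₁ η₂ b h₁ h₂ := by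
  have hη₁' : (η₁ : ℂ) ^ 2 = 1 := by exact_mod_cast hη₁
  have hη₂' : (η₂ : ℂ) ^ 2 = 1 := by exact_mod_cast hη₂
  have hη₁0 : η₁ ≠ 0 := by rintro rfl; norm_num at hη₁
  have hη₂0 : η₂ ≠ 0 := by rintro rfl; norm_num at hη₂
  have hbC : (b : ℂ) ≠ 0 := by exact_mod_cast hb
  have hbC' : 1 + (b : ℂ) ≠ 0 := by exact_mod_cast hb'
  have hs : Complex.sqrt (b * η₁) ^ 2 = ((η₁ * b : ℝ) : ℂ) := by
    rw [Complex.sqrt_sq_eq]; push_cast; ring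
  have ht : Complex.sqrt (-(η₂ * (1 + b))) ^ 2 = ((η₂ * -(1 + b) : ℝ) : ℂ) := by
    rw [Complex.sqrt_sq_eq]; push_cast; ring
  have hc : (η₁ : ℂ) * ((η₁ * c : ℝ) : ℂ) = c := by
    push_cast
    linear_combination (c : ℂ) * hη₁'
  obtain ⟨A₁, A₂, e1, x1, x1'⟩ := h.sol₁.exists_exp (p := -(c / b)) (mul_ne_zero hη₁0 hb) hs
    (by push_cast; field_simp; ring)
  obtain ⟨A₃, A₄, e2, x2, x2'⟩ := h.sol₂.exists_exp (p := -(c / (1 + b)))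
    (mul_ne_zero hη₂0 (neg_ne_zero.2 hb')) ht (by push_cast; field_simp; ring)
  refine ⟨hb, hb', η₁ * c, A₁, A₂, A₃, A₄, by simpa only [hc] using e1, by simpa only [hc] using e2,
    ?_⟩
  have hint := congrArg (fun r : ℝ => (r : ℂ)) h.first_integral
  push_cast at hint
  have := (first_integral_exp hη₁' hη₂' hbC hbC' (by simpa using hs) (by simpa using ht)
    x1 x1' x2 x2').1 hint
  push_cast
  linear_combination this + (c : ℂ) ^ 2 * hη₁'

theorem IsCurvaturePair.familyQuad₁ {η₁ η₂ c : ℝ} {h₁ h₁' h₂ h₂' : ℝ → ℝ} (hη₁ : η₁ ^ 2 = 1)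
    (hη₂ : η₂ ^ 2 = 1) (h : IsCurvaturePair η₁ η₂ 0 c h₁ h₁' h₂ h₂') :
    FamilyQuad₁ η₁ η₂ 0 h₁ h₂ := by
  have hη₁' : (η₁ : ℂ) ^ 2 = 1 := by exact_mod_cast hη₁
  have hη₂' : (η₂ : ℂ) ^ 2 = 1 := by exact_mod_cast hη₂
  have hη₂0 : η₂ ≠ 0 := by rintro rfl; norm_num at hη₂
  have ht : Complex.sqrt η₂ ^ 2 = -((η₂ * -(1 + 0) : ℝ) : ℂ) := by
    rw [Complex.sqrt_sq_eq]; push_cast; ring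
  have hc : (η₁ : ℂ) * ((η₁ * c : ℝ) : ℂ) = c := by
    push_cast
    linear_combination (c : ℂ) * hη₁'
  have h1 := h.sol₁
  rw [mul_zero] at h1
  have e1 := (h1.unique (isSolution_quadratic (η₁ * c) (h₁ 0) (h₁' 0)) (by simp) (by simp)).1
  obtain ⟨A₇, A₈, e2, x2, x2'⟩ := h.sol₂.exists_trig (p := -c)
    (mul_ne_zero hη₂0 (by norm_num)) ht (by push_cast; ring)
  refine ⟨rfl, η₁ * c, h₁' 0, h₁ 0, A₇, A₈, congrFun e1, by simpa only [hc] using e2, ?_⟩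
  have hint := congrArg (fun r : ℝ => (r : ℂ)) h.first_integral
  push_cast at hint
  refine (first_integral_trig hη₁' hη₂' (by simpa using ht) (y := h₂ 0)
    (y' := h₂' 0) (by rw [hc, x2]) x2').1 ?_
  rw [hc]
  linear_combination hint

theorem IsCurvaturePair.isCurvatureFamily {η₁ η₂ b c : ℝ} {h₁ h₁' h₂ h₂' : ℝ → ℝ}
    (hη₁ : η₁ ^ 2 = 1) (hη₂ : η₂ ^ 2 = 1) (h : IsCurvaturePair η₁ η₂ b c h₁ h₁' h₂ h₂') :
    IsCurvatureFamily η₁ η₂ b (-(1 + b)) h₁ h₂ := by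
  refine ⟨rfl, ?_⟩
  by_cases hb : b = 0
  · subst hb
    exact Or.inr (Or.inl (h.familyQuad₁ hη₁ hη₂))
  by_cases hb' : 1 + b = 0
  · have hs := h.swap
    rw [hb', neg_zero] at hs ⊢
    obtain ⟨-, c', B₇, B₈, B₅, B₆, e1, e2, hB⟩ := hs.familyQuad₁ hη₂ hη₁
    exact Or.inr (Or.inr (Or.inr ⟨rfl, c', B₇, B₈, B₅, B₆, e2, e1, hB⟩))
  · exact Or.inl (h.familyExp₁ hη₁ hη₂ hb hb')

/-! ### Gram matrices of solutions -/

section Gram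

variable {E : Type*} [NormedAddCommGroup E] [NormedSpace ℝ E]

theorem ContinuousLinearMap.hasDerivAt_apply_apply (B : E →L[ℝ] E →L[ℝ] ℝ) {S T : ℝ → E} {S' T' : E}
    {u : ℝ} (hS : HasDerivAt S S' u) (hT : HasDerivAt T T' u) :
    HasDerivAt (fun t => B (S t) (T t)) (B (S u) T' + B S' (T u)) u := by
  simpa using (B.hasFDerivAt_of_bilinear hS.hasFDerivAt hT.hasFDerivAt).hasDerivAt

/-- If the inhomogeneity `v` of `S'' = κ S + v` has constant product with `S`, then `⟨S, S⟩`
satisfies a linear equation with factor `4κ`; the hypotheses on the initial values say that both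
products start in equilibrium. -/
theorem IsSolution.gram_const {B : E →L[ℝ] E →L[ℝ] ℝ} (hB : ∀ x y, B x y = B y x) {κ : ℝ} {v : E}
    {S S' : ℝ → E} (hS : IsSolution κ v S S') (h1 : B v (S' 0) = 0)
    (h2 : κ * B v (S 0) + B v v = 0) (h3 : B (S 0) (S' 0) = 0)
    (h4 : B (S' 0) (S' 0) + κ * B (S 0) (S 0) + B v (S 0) = 0) (u : ℝ) :
    B v (S u) = B v (S 0) ∧ B v (S' u) = 0 ∧ B (S u) (S u) = B (S 0) (S 0) ∧
      B (S u) (S' u) = 0 ∧ B (S' u) (S' u) = B (S' 0) (S' 0) := by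
  have hv := (hS.clm (B v)).eq_const (by simpa using h2) h1
  have hd : ∀ u, HasDerivAt (fun u => B (S' u) (S' u) - κ * B (S u) (S u)) 0 u := by
    intro u
    refine ((B.hasDerivAt_apply_apply (hS.hasDerivAt' u) (hS.hasDerivAt' u)).sub
      ((B.hasDerivAt_apply_apply (hS.hasDerivAt u) (hS.hasDerivAt u)).const_mul κ)).congr_deriv ?_
    simp only [map_add, map_smul, add_apply, smul_apply, smul_eq_mul]
    rw [hB (S' u) v, hB (S' u) (S u), (hv u).2]
    ring
  have hconst : ∀ u, B (S' u) (S' u) - κ * B (S u) (S u)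
      = B (S' 0) (S' 0) - κ * B (S 0) (S 0) := fun u =>
    is_const_of_deriv_eq_zero (fun u => (hd u).differentiableAt) (fun u => (hd u).deriv) u 0
  have hsol : IsSolution (4 * κ) (-(4 * κ * B (S 0) (S 0))) (fun u => B (S u) (S u))
      (fun u => 2 * B (S u) (S' u)) := by
    constructor <;> intro u
    · refine (B.hasDerivAt_apply_apply (hS.hasDerivAt u) (hS.hasDerivAt u)).congr_deriv ?_
      rw [hB (S' u)]
      ring
    · refine ((B.hasDerivAt_apply_apply (hS.hasDerivAt u)
        (hS.hasDerivAt' u)).const_mul 2).congr_deriv ?_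
      simp only [map_add, map_smul, smul_eq_mul]
      rw [hB (S u) v, (hv u).1]
      linear_combination 2 * hconst u + 2 * h4
  have hc := hsol.eq_const (by simp) (by simp [h3]) u
  refine ⟨(hv u).1, (hv u).2, hc.1, by simpa using hc.2, ?_⟩
  linear_combination hconst u + κ * hc.1

/-- Two solutions of equations with different factors: all mixed products are constant in both
parameters, as solutions of scalar equations that start in equilibrium, first along `S` and then
along `T`. -/
theorem IsSolution.gram_mixed_const {B : E →L[ℝ] E →L[ℝ] ℝ} (hB : ∀ x y, B x y = B y x) {κ μ : ℝ}
    {v w : E} {S S' T T' : ℝ → E} (hS : IsSolution κ v S S') (hT : IsSolution μ w T T')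
    (h1 : B (S' 0) (T 0) = 0) (h2 : B (S 0) (T' 0) = 0) (h3 : B (S' 0) (T' 0) = 0)
    (h4 : κ * B (S 0) (T 0) + B v (T 0) = 0) (h5 : B v (T' 0) = 0)
    (h6 : ∀ u, μ * B (S 0) (T 0) + B w (S u) = 0) (h7 : ∀ u, B w (S' u) = 0) (s t : ℝ) :
    B (S s) (T t) = B (S 0) (T 0) ∧ B (S' s) (T t) = 0 ∧ B (S s) (T' t) = 0 ∧
      B (S' s) (T' t) = 0 := by
  have e1 := (hS.clm (B (T 0))).eq_const (by simpa [hB (T 0)] using h4) (by rw [hB, h1]) s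
  have e2 := (hS.clm (B (T' 0))).eq_const (by simp [hB (T' 0), h2, h5]) (by rw [hB, h3]) s
  rw [hB, hB (T 0), hB (T 0)] at e1
  rw [hB, hB (T' 0) (S 0), h2, hB (T' 0)] at e2
  have e3 := (hT.clm (B (S s))).eq_const (by simpa [e1.1, hB (S s) w] using h6 s) e2.1 t
  have e4 := (hT.clm (B (S' s))).eq_const (by simp [e1.2, hB (S' s) w, h7 s]) e2.2 t
  rw [e1.1] at e3
  rw [e1.2] at e4
  exact ⟨e3.1, e4.1, e3.2, e4.2⟩

end Gram

/-! ### The scalar product and the Lie quadric -/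

/-- The scalar product of `E³` as a continuous bilinear map. -/
noncomputable def pseudoInnerL (ε₁ ε₂ ε₃ : ℝ) : (Fin 3 → ℝ) →L[ℝ] (Fin 3 → ℝ) →L[ℝ] ℝ :=
  let π : Fin 3 → (Fin 3 → ℝ) →L[ℝ] ℝ := fun i => ContinuousLinearMap.proj i
  ε₁ • (π 0).smulRight (π 0) + ε₂ • (π 1).smulRight (π 1) + ε₃ • (π 2).smulRight (π 2)

theorem pseudoInnerL_apply (ε₁ ε₂ ε₃ : ℝ) (x y : Fin 3 → ℝ) :
    pseudoInnerL ε₁ ε₂ ε₃ x y = pseudoInner ε₁ ε₂ ε₃ x y := by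
  simp [pseudoInnerL, pseudoInner, mul_assoc]

/-- The Lie scalar product `⟨G, G'⟩ - (h q' + h' q) / 2` on triples `(G, h, q)`. A sphere of
curvature `h`, touching a surface `X` with normal `N`, has the coordinates
`G = N - h X`, `h`, `q = h ⟨X, X⟩ - 2 ⟨X, N⟩`, whose square is `⟨N, N⟩`. -/
noncomputable def lieForm (ε₁ ε₂ ε₃ : ℝ) :
    ((Fin 3 → ℝ) × ℝ × ℝ) →L[ℝ] ((Fin 3 → ℝ) × ℝ × ℝ) →L[ℝ] ℝ :=
  let g := ContinuousLinearMap.fst ℝ (Fin 3 → ℝ) (ℝ × ℝ)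
  let k := ContinuousLinearMap.snd ℝ (Fin 3 → ℝ) (ℝ × ℝ)
  let h := (ContinuousLinearMap.fst ℝ ℝ ℝ).comp k
  let q := (ContinuousLinearMap.snd ℝ ℝ ℝ).comp k
  (pseudoInnerL ε₁ ε₂ ε₃).bilinearComp g g - (1 / 2 : ℝ) • (h.smulRight q + q.smulRight h)

theorem lieForm_apply (ε₁ ε₂ ε₃ : ℝ) (G G' : Fin 3 → ℝ) (h q h' q' : ℝ) :
    lieForm ε₁ ε₂ ε₃ (G, h, q) (G', h', q')
      = pseudoInner ε₁ ε₂ ε₃ G G' - (h * q' + q * h') / 2 := by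
  simp [lieForm, pseudoInnerL_apply]
  ring

theorem pseudoInner_comm (ε₁ ε₂ ε₃ : ℝ) (x y : Fin 3 → ℝ) :
    pseudoInner ε₁ ε₂ ε₃ x y = pseudoInner ε₁ ε₂ ε₃ y x := by
  simp only [pseudoInner]
  ring

theorem lieForm_comm (ε₁ ε₂ ε₃ : ℝ) (x y : (Fin 3 → ℝ) × ℝ × ℝ) :
    lieForm ε₁ ε₂ ε₃ x y = lieForm ε₁ ε₂ ε₃ y x := by
  obtain ⟨G, h, q⟩ := x
  obtain ⟨G', h', q'⟩ := y
  rw [lieForm_apply, lieForm_apply, pseudoInner_comm]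
  ring

theorem SolvesIVP.isSolution {κ : ℝ} {v x y : Fin 3 → ℝ} {G : ℝ → Fin 3 → ℝ}
    (h : SolvesIVP κ v x y G) : IsSolution κ v G (deriv G) where
  hasDerivAt u := (h.contDiff.differentiable (by norm_num) u).hasDerivAt
  hasDerivAt' u := by
    have h2 : ContDiff ℝ 1 (deriv G) :=
      (contDiff_succ_iff_deriv.1 (by simpa [one_add_one_eq_two] using h.contDiff)).2.2
    have := (h2.differentiable (by norm_num) u).hasDerivAt
    rwa [← sub_eq_iff_eq_add'.1 (h.ode u)]

/-- The scalar products of the generating functions and their derivatives. In terms of the triples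
`Sᵢ = (Gᵢ, hᵢ, qᵢ)` they say that `S₁`, `S₂` have all squares and products equal to `ε₃` in the Lie
form, that `S₁'`, `S₂'` are orthogonal to each other and to `S₁`, `S₂`, and that the squares of `S₁'`,
`S₂'` are `ε₁`, `ε₂`. -/
structure IsGramData (ε₁ ε₂ ε₃ : ℝ) (h₁ h₁' h₂ h₂' q₁ q₁' q₂ q₂' : ℝ) (G₁ G₁' G₂ G₂' : Fin 3 → ℝ) :
    Prop where
  g₁₁ : pseudoInner ε₁ ε₂ ε₃ G₁ G₁ = ε₃ + h₁ * q₁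
  g₁₁' : pseudoInner ε₁ ε₂ ε₃ G₁ G₁' = (h₁ * q₁' + q₁ * h₁') / 2
  g₁'₁' : pseudoInner ε₁ ε₂ ε₃ G₁' G₁' = ε₁ + h₁' * q₁'
  g₂₂ : pseudoInner ε₁ ε₂ ε₃ G₂ G₂ = ε₃ + h₂ * q₂
  g₂₂' : pseudoInner ε₁ ε₂ ε₃ G₂ G₂' = (h₂ * q₂' + q₂ * h₂') / 2
  g₂'₂' : pseudoInner ε₁ ε₂ ε₃ G₂' G₂' = ε₂ + h₂' * q₂'
  g₁₂ : pseudoInner ε₁ ε₂ ε₃ G₁ G₂ = ε₃ + (h₁ * q₂ + q₁ * h₂) / 2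
  g₁'₂ : pseudoInner ε₁ ε₂ ε₃ G₁' G₂ = (h₁' * q₂ + q₁' * h₂) / 2
  g₁₂' : pseudoInner ε₁ ε₂ ε₃ G₁ G₂' = (h₁ * q₂' + q₁ * h₂') / 2
  g₁'₂' : pseudoInner ε₁ ε₂ ε₃ G₁' G₂' = (h₁' * q₂' + q₁' * h₂') / 2

theorem exists_isGramData {ε₁ ε₂ ε₃ : ℝ} (hε₁ : ε₁ ^ 2 = 1) (hε₂ : ε₂ ^ 2 = 1) (hε₃ : ε₃ ^ 2 = 1)
    {b c : ℝ} {h₁ h₁' h₂ h₂' : ℝ → ℝ} {G₁ G₂ : ℝ → Fin 3 → ℝ}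
    (hh : IsCurvaturePair (ε₃ * ε₁) (ε₃ * ε₂) b c h₁ h₁' h₂ h₂') (hf : h₁ 0 - h₂ 0 ≠ 0)
    (hG : IsGeneratingPair (ε₃ * ε₁) (ε₃ * ε₂) b (-(1 + b)) h₁ h₂ G₁ G₂) :
    ∃ q₁ q₁' q₂ q₂' : ℝ → ℝ, ∀ s t, IsGramData ε₁ ε₂ ε₃ (h₁ s) (h₁' s) (h₂ t) (h₂' t)
      (q₁ s) (q₁' s) (q₂ t) (q₂' t) (G₁ s) (deriv G₁ s) (G₂ t) (deriv G₂ t) := by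
  obtain ⟨hG₁, hG₂⟩ := hG
  have d1 : deriv h₁ 0 = h₁' 0 := (hh.sol₁.hasDerivAt 0).deriv
  have d2 : deriv h₂ 0 = h₂' 0 := (hh.sol₂.hasDerivAt 0).deriv
  have hη₁ : (ε₃ * ε₁) ^ 2 = 1 := by rw [mul_pow, hε₁, hε₃, one_mul]
  have hη₂ : (ε₃ * ε₂) ^ 2 = 1 := by rw [mul_pow, hε₂, hε₃, one_mul]
  -- `q₁(0) = q₁'(0) = q₂(0) = q₂'(0) = 0` because `X(0, 0) = 0`, and
  -- `q₁''(0) = 2 f ⟨X₁, X₁⟩ = 2 ε₁ / f` with `f = h₁(0) - h₂(0)`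
  obtain ⟨q₁, q₁', hq₁, hq₁0, hq₁0'⟩ :=
    exists_isSolution (ε₃ * ε₁ * b) (ε₃ * ε₁ * (2 * ε₃ / (h₁ 0 - h₂ 0))) 0 0
  obtain ⟨q₂, q₂', hq₂, hq₂0, hq₂0'⟩ :=
    exists_isSolution (ε₃ * ε₂ * -(1 + b)) (-(ε₃ * ε₂ * (2 * ε₃ / (h₁ 0 - h₂ 0)))) 0 0
  have hS := hG₁.isSolution.prodMk (hh.sol₁.prodMk hq₁)
  have hT := hG₂.isSolution.prodMk (hh.sol₂.prodMk hq₂)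
  set f := h₁ 0 - h₂ 0 with hfd
  -- the common inhomogeneity of both equations, up to the factors `η₁` and `-η₂`
  obtain ⟨C, hC⟩ : ∃ C : (Fin 3 → ℝ) × ℝ × ℝ, C = (![ε₃ * ε₁ * h₁' 0 / f, ε₃ * ε₂ * h₂' 0 / f,
    h₂ 0 / f - b], c, 2 * ε₃ / f) := ⟨_, rfl⟩
  have hv₁ : (vecOne (ε₃ * ε₁) (ε₃ * ε₂) b h₁ h₂, ε₃ * ε₁ * c, ε₃ * ε₁ * (2 * ε₃ / f))
      = (ε₃ * ε₁) • C := by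
    rw [hC]
    refine Prod.ext ?_ rfl
    simp only [vecOne, d1, d2, Prod.smul_mk]
    rw [show h₂ 0 - h₁ 0 = -f by rw [hfd]; ring]
    ext i
    fin_cases i <;> simp <;> field_simp <;> ring
  have hv₂ : (vecTwo (ε₃ * ε₁) (ε₃ * ε₂) b h₁ h₂, -(ε₃ * ε₂ * c), -(ε₃ * ε₂ * (2 * ε₃ / f)))
      = -(ε₃ * ε₂) • C := by
    have : vecOne (ε₃ * ε₁) (ε₃ * ε₂) b h₁ h₂ = (ε₃ * ε₁) • C.1 := congrArg Prod.fst hv₁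
    rw [vecTwo, this, smul_smul, show ε₃ * ε₁ * (ε₃ * ε₂) * (ε₃ * ε₁) = ε₃ * ε₂ by
      linear_combination (ε₃ * ε₂) * hη₁, hC]
    simp
  rw [hv₁] at hS
  rw [hv₂] at hT
  have hCS : lieForm ε₁ ε₂ ε₃ C (G₁ 0, h₁ 0, q₁ 0) = -(1 + b) * ε₃ := by
    rw [hC, hG₁.init, hq₁0, lieForm_apply]
    simp [pseudoInner]
    rw [show h₁ 0 = f + h₂ 0 by rw [hfd]; ring]
    field_simp
    ring
  have hCS' : lieForm ε₁ ε₂ ε₃ C (deriv G₁ 0, h₁' 0, q₁' 0) = 0 := by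
    rw [hC, hG₁.init_deriv, hq₁0', lieForm_apply]
    simp [pseudoInner]
    field_simp
    linear_combination h₁' 0 * ε₃ * hε₁
  have hCT : lieForm ε₁ ε₂ ε₃ C (G₂ 0, h₂ 0, q₂ 0) = -b * ε₃ := by
    rw [hC, hG₂.init, hq₂0, lieForm_apply]
    simp [pseudoInner]
    field_simp
    ring
  have hCT' : lieForm ε₁ ε₂ ε₃ C (deriv G₂ 0, h₂' 0, q₂' 0) = 0 := by
    rw [hC, hG₂.init_deriv, hq₂0', lieForm_apply]
    simp [pseudoInner]
    field_simp
    linear_combination h₂' 0 * ε₃ * hε₂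
  have hCC : lieForm ε₁ ε₂ ε₃ C C = b * (1 + b) * ε₃ := by
    have hint := hh.first_integral
    rw [hC, lieForm_apply]
    simp [pseudoInner]
    field_simp
    rw [hfd]
    linear_combination -ε₃ * hint + ε₃ ^ 2 * ε₁ * h₁' 0 ^ 2 * hε₁
      + ε₃ ^ 2 * ε₂ * h₂' 0 ^ 2 * hε₂
  have eS := fun u => hS.gram_const (lieForm_comm ε₁ ε₂ ε₃)
    (by simp [hCS']) (by simp [hCS, hCC]; ring)
    (by
      rw [hG₁.init, hG₁.init_deriv, hq₁0, hq₁0', lieForm_apply]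
      simp [pseudoInner])
    (by
      simp only [map_smul, smul_apply, hCS]
      rw [hG₁.init, hG₁.init_deriv, hq₁0, hq₁0', lieForm_apply, lieForm_apply]
      simp [pseudoInner]
      linear_combination -ε₁ * hε₃) u
  have eT := fun u => hT.gram_const (lieForm_comm ε₁ ε₂ ε₃)
    (by simp [hCT']) (by simp [hCT, hCC]; ring)
    (by
      rw [hG₂.init, hG₂.init_deriv, hq₂0, hq₂0', lieForm_apply]
      simp [pseudoInner])
    (by
      simp only [map_smul, smul_apply, hCT]
      rw [hG₂.init, hG₂.init_deriv, hq₂0, hq₂0', lieForm_apply, lieForm_apply]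
      simp [pseudoInner]
      linear_combination -ε₂ * hε₃) u
  have hST : lieForm ε₁ ε₂ ε₃ (G₁ 0, h₁ 0, q₁ 0) (G₂ 0, h₂ 0, q₂ 0) = ε₃ := by
    rw [hG₁.init, hG₂.init, hq₁0, hq₂0, lieForm_apply]
    simp [pseudoInner]
  have hη₁0 : ε₃ * ε₁ ≠ 0 := fun h => by simp [h] at hη₁
  have eST := fun s t => hS.gram_mixed_const (lieForm_comm ε₁ ε₂ ε₃) hT
    (by
      rw [hG₁.init_deriv, hG₂.init, hq₁0', hq₂0, lieForm_apply]
      simp [pseudoInner])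
    (by
      rw [hG₁.init, hG₂.init_deriv, hq₁0, hq₂0', lieForm_apply]
      simp [pseudoInner])
    (by
      rw [hG₁.init_deriv, hG₂.init_deriv, hq₁0', hq₂0', lieForm_apply]
      simp [pseudoInner])
    (by
      simp only [map_smul, smul_apply, hCT, hST, smul_eq_mul]
      ring)
    (by simp [hCT'])
    (fun u => by
      have := (eS u).1
      simp only [map_smul, smul_apply, hCS, smul_eq_mul] at this
      simp only [map_smul, smul_apply, hST, smul_eq_mul, mul_left_cancel₀ hη₁0 this]
      ring)
    (fun u => by
      have := (eS u).2.1
      simp only [map_smul, smul_apply, smul_eq_mul, mul_eq_zero, hη₁0, false_or] at this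
      simp [this]) s t
  have eS0 : lieForm ε₁ ε₂ ε₃ (G₁ 0, h₁ 0, q₁ 0) (G₁ 0, h₁ 0, q₁ 0) = ε₃ := by
    rw [hG₁.init, hq₁0, lieForm_apply]
    simp [pseudoInner]
  have eS0' : lieForm ε₁ ε₂ ε₃ (deriv G₁ 0, h₁' 0, q₁' 0) (deriv G₁ 0, h₁' 0, q₁' 0) = ε₁ := by
    rw [hG₁.init_deriv, hq₁0', lieForm_apply]
    simp [pseudoInner]
  have eT0 : lieForm ε₁ ε₂ ε₃ (G₂ 0, h₂ 0, q₂ 0) (G₂ 0, h₂ 0, q₂ 0) = ε₃ := by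
    rw [hG₂.init, hq₂0, lieForm_apply]
    simp [pseudoInner]
  have eT0' : lieForm ε₁ ε₂ ε₃ (deriv G₂ 0, h₂' 0, q₂' 0) (deriv G₂ 0, h₂' 0, q₂' 0) = ε₂ := by
    rw [hG₂.init_deriv, hq₂0', lieForm_apply]
    simp [pseudoInner]
  simp only [eS0, eS0', lieForm_apply] at eS
  simp only [eT0, eT0', lieForm_apply] at eT
  simp only [hST, lieForm_apply] at eST
  refine ⟨q₁, q₁', q₂, q₂', fun s t => ?_⟩
  obtain ⟨-, -, a1, a2, a3⟩ := eS s
  obtain ⟨-, -, b1, b2, b3⟩ := eT t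
  obtain ⟨c1, c2, c3, c4⟩ := eST s t
  constructor
  · linear_combination a1
  · linear_combination a2
  · linear_combination a3
  · linear_combination b1
  · linear_combination b2
  · linear_combination b3
  · linear_combination c1
  · linear_combination c2
  · linear_combination c3
  · linear_combination c4

/-! ### The surface built from the generating functions -/

/-- The normal field `(h₁ G₂ - h₂ G₁) / (h₁ - h₂)` of `dupinParam h₁ h₂ G₁ G₂`. -/
noncomputable def dupinNormal (h₁ h₂ : ℝ → ℝ) (G₁ G₂ : ℝ → Fin 3 → ℝ) (p : ℝ × ℝ) : Fin 3 → ℝ :=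
  (h₁ p.1 - h₂ p.2)⁻¹ • (h₁ p.1 • G₂ p.2 - h₂ p.2 • G₁ p.1)

section PartialDerivatives

variable {E : Type*} [NormedAddCommGroup E] [NormedSpace ℝ E]

theorem HasDerivAt.comp_fst_prod {g : ℝ → E} {g' : E} {p : ℝ × ℝ} (hg : HasDerivAt g g' p.1) :
    HasFDerivAt (fun q : ℝ × ℝ => g q.1) ((ContinuousLinearMap.fst ℝ ℝ ℝ).smulRight g') p := by
  refine (HasFDerivAt.comp p hg.hasFDerivAt hasFDerivAt_fst).congr_fderiv ?_
  ext <;> simp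

theorem HasDerivAt.comp_snd_prod {g : ℝ → E} {g' : E} {p : ℝ × ℝ} (hg : HasDerivAt g g' p.2) :
    HasFDerivAt (fun q : ℝ × ℝ => g q.2) ((ContinuousLinearMap.snd ℝ ℝ ℝ).smulRight g') p := by
  refine (HasFDerivAt.comp p hg.hasFDerivAt hasFDerivAt_snd).congr_fderiv ?_
  ext <;> simp

theorem HasFDerivAt.inv_smul_apply {F : Type*} [NormedAddCommGroup F] [NormedSpace ℝ F]
    {f : F → ℝ} {f' : F →L[ℝ] ℝ} {V : F → E} {V' : F →L[ℝ] E} {p : F}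
    (hf : HasFDerivAt f f' p) (hV : HasFDerivAt V V' p) (h0 : f p ≠ 0) (w : F) :
    fderiv ℝ (fun q => (f q)⁻¹ • V q) p w = (f p ^ 2)⁻¹ • (f p • V' w - f' w • V p) := by
  have h := ((hasDerivAt_inv h0).comp_hasFDerivAt p hf).smul hV
  have h2 : HasFDerivAt (fun q => (f q)⁻¹ • V q) _ p := h
  rw [h2.fderiv]
  simp only [Function.comp_apply, add_apply, smul_apply, ContinuousLinearMap.smulRight_apply,
    smul_sub, smul_smul, smul_eq_mul]
  rw [show (f p ^ 2)⁻¹ * f p = (f p)⁻¹ by field_simp]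
  module

end PartialDerivatives

section DupinParam

variable {h₁ h₁' h₂ h₂' : ℝ → ℝ} {G₁ G₁' G₂ G₂' : ℝ → Fin 3 → ℝ} {p : ℝ × ℝ}

theorem fderiv_dupinParam (dh₁ : HasDerivAt h₁ (h₁' p.1) p.1) (dh₂ : HasDerivAt h₂ (h₂' p.2) p.2)
    (dG₁ : HasDerivAt G₁ (G₁' p.1) p.1) (dG₂ : HasDerivAt G₂ (G₂' p.2) p.2)
    (hf : h₁ p.1 - h₂ p.2 ≠ 0) :
    partial₁ (dupinParam h₁ h₂ G₁ G₂) p = ((h₁ p.1 - h₂ p.2) ^ 2)⁻¹ •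
        -((h₁ p.1 - h₂ p.2) • G₁' p.1 + h₁' p.1 • (G₂ p.2 - G₁ p.1)) ∧
      partial₂ (dupinParam h₁ h₂ G₁ G₂) p = ((h₁ p.1 - h₂ p.2) ^ 2)⁻¹ •
        ((h₁ p.1 - h₂ p.2) • G₂' p.2 + h₂' p.2 • (G₂ p.2 - G₁ p.1)) := by
  have key := HasFDerivAt.inv_smul_apply (dh₁.comp_fst_prod.fun_sub dh₂.comp_snd_prod)
    (dG₂.comp_snd_prod.fun_sub dG₁.comp_fst_prod) hf
  refine ⟨(key _).trans ?_, (key _).trans ?_⟩ <;> congr 1 <;> simp <;> module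

theorem fderiv_dupinNormal (dh₁ : HasDerivAt h₁ (h₁' p.1) p.1) (dh₂ : HasDerivAt h₂ (h₂' p.2) p.2)
    (dG₁ : HasDerivAt G₁ (G₁' p.1) p.1) (dG₂ : HasDerivAt G₂ (G₂' p.2) p.2)
    (hf : h₁ p.1 - h₂ p.2 ≠ 0) :
    partial₁ (dupinNormal h₁ h₂ G₁ G₂) p = h₂ p.2 • partial₁ (dupinParam h₁ h₂ G₁ G₂) p ∧
      partial₂ (dupinNormal h₁ h₂ G₁ G₂) p = h₁ p.1 • partial₂ (dupinParam h₁ h₂ G₁ G₂) p := by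
  have key := HasFDerivAt.inv_smul_apply (dh₁.comp_fst_prod.fun_sub dh₂.comp_snd_prod)
    ((dh₁.comp_fst_prod.fun_smul dG₂.comp_snd_prod).fun_sub
      (dh₂.comp_snd_prod.fun_smul dG₁.comp_fst_prod)) hf
  rw [(fderiv_dupinParam dh₁ dh₂ dG₁ dG₂ hf).1, (fderiv_dupinParam dh₁ dh₂ dG₁ dG₂ hf).2,
    smul_comm (h₂ p.2), smul_comm (h₁ p.1)]
  refine ⟨(key _).trans ?_, (key _).trans ?_⟩ <;> (congr 1; simp; module)

end DupinParam

theorem pseudoInner_smul_smul (ε₁ ε₂ ε₃ a b : ℝ) (x y : Fin 3 → ℝ) :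
    pseudoInner ε₁ ε₂ ε₃ (a • x) (b • y) = a * b * pseudoInner ε₁ ε₂ ε₃ x y := by
  simp only [pseudoInner, Pi.smul_apply, smul_eq_mul]
  ring

theorem pseudoInner_smul_right (ε₁ ε₂ ε₃ r : ℝ) (x y : Fin 3 → ℝ) :
    pseudoInner ε₁ ε₂ ε₃ x (r • y) = r * pseudoInner ε₁ ε₂ ε₃ x y := by
  simpa using pseudoInner_smul_smul ε₁ ε₂ ε₃ 1 r x y

theorem pseudoInner_smul_left (ε₁ ε₂ ε₃ r : ℝ) (x y : Fin 3 → ℝ) :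
    pseudoInner ε₁ ε₂ ε₃ (r • x) y = r * pseudoInner ε₁ ε₂ ε₃ x y := by
  simpa using pseudoInner_smul_smul ε₁ ε₂ ε₃ r 1 x y

theorem pseudoInner_add_left (ε₁ ε₂ ε₃ : ℝ) (x y z : Fin 3 → ℝ) :
    pseudoInner ε₁ ε₂ ε₃ (x + y) z = pseudoInner ε₁ ε₂ ε₃ x z + pseudoInner ε₁ ε₂ ε₃ y z := by
  simp only [pseudoInner, Pi.add_apply]
  ring

section GramAlgebra

variable {ε₁ ε₂ ε₃ h₁ h₁' h₂ h₂' q₁ q₁' q₂ q₂' : ℝ} {G₁ G₁' G₂ G₂' : Fin 3 → ℝ}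

theorem IsGramData.partial₁_partial₁
    (g : IsGramData ε₁ ε₂ ε₃ h₁ h₁' h₂ h₂' q₁ q₁' q₂ q₂' G₁ G₁' G₂ G₂') :
    pseudoInner ε₁ ε₂ ε₃ (-((h₁ - h₂) • G₁' + h₁' • (G₂ - G₁)))
      (-((h₁ - h₂) • G₁' + h₁' • (G₂ - G₁))) = (h₁ - h₂) ^ 2 * ε₁ := by
  obtain ⟨g₁₁, g₁₁', g₁'₁', g₂₂, g₂₂', g₂'₂', g₁₂, g₁'₂, g₁₂', g₁'₂'⟩ := g
  simp only [pseudoInner, Pi.neg_apply, Pi.add_apply, Pi.sub_apply, Pi.smul_apply,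
    smul_eq_mul] at *
  linear_combination (h₁ - h₂) ^ 2 * g₁'₁' + 2 * (h₁ - h₂) * h₁' * (g₁'₂ - g₁₁')
    + h₁' ^ 2 * (g₂₂ - 2 * g₁₂ + g₁₁)

theorem IsGramData.partial₂_partial₂
    (g : IsGramData ε₁ ε₂ ε₃ h₁ h₁' h₂ h₂' q₁ q₁' q₂ q₂' G₁ G₁' G₂ G₂') :
    pseudoInner ε₁ ε₂ ε₃ ((h₁ - h₂) • G₂' + h₂' • (G₂ - G₁))
      ((h₁ - h₂) • G₂' + h₂' • (G₂ - G₁)) = (h₁ - h₂) ^ 2 * ε₂ := by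
  obtain ⟨g₁₁, g₁₁', g₁'₁', g₂₂, g₂₂', g₂'₂', g₁₂, g₁'₂, g₁₂', g₁'₂'⟩ := g
  simp only [pseudoInner, Pi.add_apply, Pi.sub_apply, Pi.smul_apply, smul_eq_mul] at *
  linear_combination (h₁ - h₂) ^ 2 * g₂'₂' + 2 * (h₁ - h₂) * h₂' * (g₂₂' - g₁₂')
    + h₂' ^ 2 * (g₂₂ - 2 * g₁₂ + g₁₁)

theorem IsGramData.partial₁_partial₂
    (g : IsGramData ε₁ ε₂ ε₃ h₁ h₁' h₂ h₂' q₁ q₁' q₂ q₂' G₁ G₁' G₂ G₂') :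
    pseudoInner ε₁ ε₂ ε₃ (-((h₁ - h₂) • G₁' + h₁' • (G₂ - G₁)))
      ((h₁ - h₂) • G₂' + h₂' • (G₂ - G₁)) = 0 := by
  obtain ⟨g₁₁, g₁₁', g₁'₁', g₂₂, g₂₂', g₂'₂', g₁₂, g₁'₂, g₁₂', g₁'₂'⟩ := g
  simp only [pseudoInner, Pi.neg_apply, Pi.add_apply, Pi.sub_apply, Pi.smul_apply,
    smul_eq_mul] at *
  linear_combination -(h₁ - h₂) ^ 2 * g₁'₂' - (h₁ - h₂) * h₂' * (g₁'₂ - g₁₁')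
    - (h₁ - h₂) * h₁' * (g₂₂' - g₁₂') - h₁' * h₂' * (g₂₂ - 2 * g₁₂ + g₁₁)

theorem IsGramData.normal_normal
    (g : IsGramData ε₁ ε₂ ε₃ h₁ h₁' h₂ h₂' q₁ q₁' q₂ q₂' G₁ G₁' G₂ G₂') :
    pseudoInner ε₁ ε₂ ε₃ (h₁ • G₂ - h₂ • G₁) (h₁ • G₂ - h₂ • G₁) = (h₁ - h₂) ^ 2 * ε₃ := by
  obtain ⟨g₁₁, g₁₁', g₁'₁', g₂₂, g₂₂', g₂'₂', g₁₂, g₁'₂, g₁₂', g₁'₂'⟩ := g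
  simp only [pseudoInner, Pi.sub_apply, Pi.smul_apply, smul_eq_mul] at *
  linear_combination h₁ ^ 2 * g₂₂ - 2 * h₁ * h₂ * g₁₂ + h₂ ^ 2 * g₁₁

theorem IsGramData.normal_partial₁
    (g : IsGramData ε₁ ε₂ ε₃ h₁ h₁' h₂ h₂' q₁ q₁' q₂ q₂' G₁ G₁' G₂ G₂') :
    pseudoInner ε₁ ε₂ ε₃ (h₁ • G₂ - h₂ • G₁) (-((h₁ - h₂) • G₁' + h₁' • (G₂ - G₁))) = 0 := by
  obtain ⟨g₁₁, g₁₁', g₁'₁', g₂₂, g₂₂', g₂'₂', g₁₂, g₁'₂, g₁₂', g₁'₂'⟩ := g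
  simp only [pseudoInner, Pi.neg_apply, Pi.add_apply, Pi.sub_apply, Pi.smul_apply,
    smul_eq_mul] at *
  linear_combination -(h₁ - h₂) * (h₁ * g₁'₂ - h₂ * g₁₁')
    - h₁' * (h₁ * (g₂₂ - g₁₂) - h₂ * (g₁₂ - g₁₁))

theorem IsGramData.normal_partial₂
    (g : IsGramData ε₁ ε₂ ε₃ h₁ h₁' h₂ h₂' q₁ q₁' q₂ q₂' G₁ G₁' G₂ G₂') :
    pseudoInner ε₁ ε₂ ε₃ (h₁ • G₂ - h₂ • G₁) ((h₁ - h₂) • G₂' + h₂' • (G₂ - G₁)) = 0 := by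
  obtain ⟨g₁₁, g₁₁', g₁'₁', g₂₂, g₂₂', g₂'₂', g₁₂, g₁'₂, g₁₂', g₁'₂'⟩ := g
  simp only [pseudoInner, Pi.add_apply, Pi.sub_apply, Pi.smul_apply, smul_eq_mul] at *
  linear_combination (h₁ - h₂) * (h₁ * g₂₂' - h₂ * g₁₂')
    + h₂' * (h₁ * (g₂₂ - g₁₂) - h₂ * (g₁₂ - g₁₁))

end GramAlgebra

theorem injective_of_orthogonal {ε₁ ε₂ ε₃ : ℝ} {L : ℝ × ℝ →L[ℝ] Fin 3 → ℝ}
    (h₁₁ : pseudoInner ε₁ ε₂ ε₃ (L (1, 0)) (L (1, 0)) ≠ 0)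
    (h₂₂ : pseudoInner ε₁ ε₂ ε₃ (L (0, 1)) (L (0, 1)) ≠ 0)
    (h₁₂ : pseudoInner ε₁ ε₂ ε₃ (L (1, 0)) (L (0, 1)) = 0) : Function.Injective L := by
  refine (injective_iff_map_eq_zero L).2 fun w hw => ?_
  have hw' : w = w.1 • ((1 : ℝ), (0 : ℝ)) + w.2 • ((0 : ℝ), (1 : ℝ)) := by ext <;> simp
  have hL : w.1 • L (1, 0) + w.2 • L (0, 1) = 0 := by
    rw [← map_smul, ← map_smul, ← map_add, ← hw', hw]
  have hi : ∀ i, w.1 * L (1, 0) i + w.2 * L (0, 1) i = 0 := fun i => congrFun hL i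
  simp only [pseudoInner] at h₁₁ h₂₂ h₁₂
  have e1 : w.1 = 0 := by
    refine (mul_eq_zero.1 ?_).resolve_right h₁₁
    linear_combination ε₁ * L (1, 0) 0 * hi 0 + ε₂ * L (1, 0) 1 * hi 1
      + ε₃ * L (1, 0) 2 * hi 2 - w.2 * h₁₂
  have e2 : w.2 = 0 := by
    refine (mul_eq_zero.1 ?_).resolve_right h₂₂
    linear_combination ε₁ * L (0, 1) 0 * hi 0 + ε₂ * L (0, 1) 1 * hi 1
      + ε₃ * L (0, 1) 2 * hi 2 - w.1 * h₁₂
  exact Prod.ext e1 e2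

theorem isIsothermicDupinSurface_dupinParam {ε₁ ε₂ ε₃ : ℝ} (hε₁ : ε₁ ^ 2 = 1) (hε₂ : ε₂ ^ 2 = 1)
    (hε₃ : ε₃ ^ 2 = 1) {U : Set (ℝ × ℝ)} (h0 : (0, 0) ∈ U) {b c : ℝ} {h₁ h₁' h₂ h₂' : ℝ → ℝ}
    {G₁ G₂ : ℝ → Fin 3 → ℝ} (hh : IsCurvaturePair (ε₃ * ε₁) (ε₃ * ε₂) b c h₁ h₁' h₂ h₂')
    (hU : ∀ p ∈ U, h₁ p.1 ≠ h₂ p.2)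
    (hG : IsGeneratingPair (ε₃ * ε₁) (ε₃ * ε₂) b (-(1 + b)) h₁ h₂ G₁ G₂) :
    IsIsothermicDupinSurface ε₁ ε₂ ε₃ U (dupinParam h₁ h₂ G₁ G₂) (dupinNormal h₁ h₂ G₁ G₂)
      (fun p => h₂ p.2) (fun p => h₁ p.1) := by
  have hf : ∀ p ∈ U, h₁ p.1 - h₂ p.2 ≠ 0 := fun p hp => sub_ne_zero.2 (hU p hp)
  obtain ⟨q₁, q₁', q₂, q₂', g⟩ := exists_isGramData hε₁ hε₂ hε₃ hh (hf _ h0) hG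
  have hX := fun p hp => fderiv_dupinParam (p := p) (hh.sol₁.hasDerivAt _) (hh.sol₂.hasDerivAt _)
    (hG.1.isSolution.hasDerivAt _) (hG.2.isSolution.hasDerivAt _) (hf p hp)
  have hN := fun p hp => fderiv_dupinNormal (p := p) (hh.sol₁.hasDerivAt _) (hh.sol₂.hasDerivAt _)
    (hG.1.isSolution.hasDerivAt _) (hG.2.isSolution.hasDerivAt _) (hf p hp)
  have ch₁ : ContDiff ℝ ∞ fun p : ℝ × ℝ => h₁ p.1 := hh.sol₁.contDiff.1.comp contDiff_fst
  have ch₂ : ContDiff ℝ ∞ fun p : ℝ × ℝ => h₂ p.2 := hh.sol₂.contDiff.1.comp contDiff_snd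
  have cG₁ : ContDiff ℝ ∞ fun p : ℝ × ℝ => G₁ p.1 := hG.1.isSolution.contDiff.1.comp contDiff_fst
  have cG₂ : ContDiff ℝ ∞ fun p : ℝ × ℝ => G₂ p.2 := hG.2.isSolution.contDiff.1.comp contDiff_snd
  have cf : ContDiffOn ℝ ∞ (fun p : ℝ × ℝ => (h₁ p.1 - h₂ p.2)⁻¹) U :=
    (ch₁.sub ch₂).contDiffOn.inv hf
  have m₁ : ∀ p ∈ U, pseudoInner ε₁ ε₂ ε₃ (partial₁ (dupinParam h₁ h₂ G₁ G₂) p)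
      (partial₁ (dupinParam h₁ h₂ G₁ G₂) p) = ε₁ / (h₁ p.1 - h₂ p.2) ^ 2 := fun p hp => by
    have := hf p hp
    rw [(hX p hp).1, pseudoInner_smul_smul, (g p.1 p.2).partial₁_partial₁]
    field_simp
  have m₂ : ∀ p ∈ U, pseudoInner ε₁ ε₂ ε₃ (partial₂ (dupinParam h₁ h₂ G₁ G₂) p)
      (partial₂ (dupinParam h₁ h₂ G₁ G₂) p) = ε₂ / (h₁ p.1 - h₂ p.2) ^ 2 := fun p hp => by
    have := hf p hp
    rw [(hX p hp).2, pseudoInner_smul_smul, (g p.1 p.2).partial₂_partial₂]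
    field_simp
  have m₁₂ : ∀ p ∈ U, pseudoInner ε₁ ε₂ ε₃ (partial₁ (dupinParam h₁ h₂ G₁ G₂) p)
      (partial₂ (dupinParam h₁ h₂ G₁ G₂) p) = 0 := fun p hp => by
    rw [(hX p hp).1, (hX p hp).2, pseudoInner_smul_smul, (g p.1 p.2).partial₁_partial₂, mul_zero]
  exact
    { smooth_param := cf.smul (cG₂.sub cG₁).contDiffOn
      smooth_normal := cf.smul ((ch₁.smul cG₂).sub (ch₂.smul cG₁)).contDiffOn
      immersion := fun p hp => by
        have h1 : ε₁ ≠ 0 := fun h => by simp [h] at hε₁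
        have h2 : ε₂ ≠ 0 := fun h => by simp [h] at hε₂
        exact injective_of_orthogonal ((m₁ p hp).trans_ne (div_ne_zero h1 (pow_ne_zero 2 (hf p hp))))
          ((m₂ p hp).trans_ne (div_ne_zero h2 (pow_ne_zero 2 (hf p hp)))) (m₁₂ p hp)
      normal_unit := fun p hp => by
        have := hf p hp
        rw [dupinNormal, pseudoInner_smul_smul, (g p.1 p.2).normal_normal]
        field_simp
      normal_orth₁ := fun p hp => by
        rw [(hX p hp).1, dupinNormal, pseudoInner_smul_smul, (g p.1 p.2).normal_partial₁, mul_zero]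
      normal_orth₂ := fun p hp => by
        rw [(hX p hp).2, dupinNormal, pseudoInner_smul_smul, (g p.1 p.2).normal_partial₂, mul_zero]
      orth := m₁₂
      curvature₁ := fun p hp => (hN p hp).1
      curvature₂ := fun p hp => (hN p hp).2
      distinct := fun p hp => (hU p hp).symm
      dupin₁ := fun p _ => by
        simpa using (hh.sol₂.hasDerivAt p.2).comp_snd_prod.hasLineDerivAt (1, 0)
      dupin₂ := fun p _ => by
        simpa using (hh.sol₁.hasDerivAt p.1).comp_fst_prod.hasLineDerivAt (0, 1)
      metric₁ := m₁
      metric₂ := m₂ }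

/-! ### Partial derivatives of smooth functions on open sets -/

section SmoothOn

variable {E : Type*} [NormedAddCommGroup E] [NormedSpace ℝ E] {U : Set (ℝ × ℝ)}

theorem ContDiffOn.differentiableAt_of_isOpen {φ : ℝ × ℝ → E} (hφ : ContDiffOn ℝ ∞ φ U)
    (hU : IsOpen U) {p : ℝ × ℝ} (hp : p ∈ U) : DifferentiableAt ℝ φ p :=
  (hφ.contDiffAt (hU.mem_nhds hp)).differentiableAt (by simp)

theorem ContDiffOn.fderiv_apply_const {φ : ℝ × ℝ → E} (hφ : ContDiffOn ℝ ∞ φ U) (hU : IsOpen U)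
    (v : ℝ × ℝ) : ContDiffOn ℝ ∞ (fun p => fderiv ℝ φ p v) U :=
  (hφ.fderiv_of_isOpen hU (by simp)).clm_apply contDiffOn_const

theorem fderiv_congr_on {φ ψ : ℝ × ℝ → E} (hU : IsOpen U) (h : ∀ p ∈ U, φ p = ψ p) {p : ℝ × ℝ}
    (hp : p ∈ U) : fderiv ℝ φ p = fderiv ℝ ψ p :=
  Filter.EventuallyEq.fderiv_eq (Filter.mem_of_superset (hU.mem_nhds hp) h)

theorem fderiv_eq_zero_of_const {φ : ℝ × ℝ → E} {x : E} (hU : IsOpen U) (h : ∀ p ∈ U, φ p = x)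
    {p : ℝ × ℝ} (hp : p ∈ U) : fderiv ℝ φ p = 0 := by
  rw [fderiv_congr_on hU (ψ := fun _ => x) h hp]
  simp

theorem fderiv_fderiv_comm {φ : ℝ × ℝ → E} (hφ : ContDiffOn ℝ ∞ φ U) (hU : IsOpen U) (v w : ℝ × ℝ)
    {p : ℝ × ℝ} (hp : p ∈ U) :
    fderiv ℝ (fun q => fderiv ℝ φ q v) p w = fderiv ℝ (fun q => fderiv ℝ φ q w) p v := by
  have hd : DifferentiableAt ℝ (fderiv ℝ φ) p :=
    ((hφ.fderiv_of_isOpen hU (m := ∞) (by simp)).contDiffAt (hU.mem_nhds hp)).differentiableAt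
      (by simp)
  have hs : IsSymmSndFDerivAt ℝ φ p :=
    (contDiffAt_infty.1 (hφ.contDiffAt (hU.mem_nhds hp)) 2).isSymmSndFDerivAt (by simp)
  rw [fderiv_clm_apply hd (differentiableAt_const v), fderiv_clm_apply hd (differentiableAt_const w)]
  simpa using hs w v

theorem fderiv_pseudoInner (ε₁ ε₂ ε₃ : ℝ) {φ ψ : ℝ × ℝ → Fin 3 → ℝ} {p : ℝ × ℝ}
    (hφ : DifferentiableAt ℝ φ p) (hψ : DifferentiableAt ℝ ψ p) (v : ℝ × ℝ) :
    fderiv ℝ (fun q => pseudoInner ε₁ ε₂ ε₃ (φ q) (ψ q)) p v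
      = pseudoInner ε₁ ε₂ ε₃ (fderiv ℝ φ p v) (ψ p)
        + pseudoInner ε₁ ε₂ ε₃ (φ p) (fderiv ℝ ψ p v) := by
  have h := (pseudoInnerL ε₁ ε₂ ε₃).hasFDerivAt_of_bilinear hφ.hasFDerivAt hψ.hasFDerivAt
  simp only [pseudoInnerL_apply] at h
  rw [h.fderiv]
  simp [pseudoInnerL_apply, add_comm]

theorem ContDiffOn.pseudoInner {φ ψ : ℝ × ℝ → Fin 3 → ℝ} (hφ : ContDiffOn ℝ ∞ φ U)
    (hψ : ContDiffOn ℝ ∞ ψ U) (ε₁ ε₂ ε₃ : ℝ) :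
    ContDiffOn ℝ ∞ (fun q => pseudoInner ε₁ ε₂ ε₃ (φ q) (ψ q)) U := by
  rw [contDiffOn_pi] at hφ hψ
  exact (((contDiffOn_const.mul (hφ 0)).mul (hψ 0)).add
    ((contDiffOn_const.mul (hφ 1)).mul (hψ 1))).add ((contDiffOn_const.mul (hφ 2)).mul (hψ 2))

end SmoothOn

/-! ### Orthonormal frames -/

/-- `e` is an orthonormal frame of `E³`, with the signs of the standard basis. -/
structure IsOrthonormalFrame (ε₁ ε₂ ε₃ : ℝ) (e₁ e₂ e₃ : Fin 3 → ℝ) : Prop where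
  e₁₁ : pseudoInner ε₁ ε₂ ε₃ e₁ e₁ = ε₁
  e₂₂ : pseudoInner ε₁ ε₂ ε₃ e₂ e₂ = ε₂
  e₃₃ : pseudoInner ε₁ ε₂ ε₃ e₃ e₃ = ε₃
  e₁₂ : pseudoInner ε₁ ε₂ ε₃ e₁ e₂ = 0
  e₃₁ : pseudoInner ε₁ ε₂ ε₃ e₃ e₁ = 0
  e₃₂ : pseudoInner ε₁ ε₂ ε₃ e₃ e₂ = 0

section Frame

variable {ε₁ ε₂ ε₃ : ℝ} {e₁ e₂ e₃ : Fin 3 → ℝ}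

theorem IsOrthonormalFrame.inner_comb (he : IsOrthonormalFrame ε₁ ε₂ ε₃ e₁ e₂ e₃)
    (x y : Fin 3 → ℝ) : pseudoInner ε₁ ε₂ ε₃ (x 0 • e₁ + x 1 • e₂ + x 2 • e₃)
      (y 0 • e₁ + y 1 • e₂ + y 2 • e₃) = pseudoInner ε₁ ε₂ ε₃ x y := by
  obtain ⟨h₁₁, h₂₂, h₃₃, h₁₂, h₃₁, h₃₂⟩ := he
  simp only [pseudoInner, Pi.add_apply, Pi.smul_apply, smul_eq_mul] at *
  linear_combination x 0 * y 0 * h₁₁ + x 1 * y 1 * h₂₂ + x 2 * y 2 * h₃₃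
    + (x 0 * y 1 + x 1 * y 0) * h₁₂ + (x 2 * y 0 + x 0 * y 2) * h₃₁
    + (x 2 * y 1 + x 1 * y 2) * h₃₂

/-- The isometry of `E³` that maps an orthonormal frame to the standard basis. -/
theorem IsOrthonormalFrame.exists_linearEquiv (hε₁ : ε₁ ^ 2 = 1) (hε₂ : ε₂ ^ 2 = 1)
    (hε₃ : ε₃ ^ 2 = 1) (he : IsOrthonormalFrame ε₁ ε₂ ε₃ e₁ e₂ e₃) :
    ∃ A : (Fin 3 → ℝ) ≃ₗ[ℝ] (Fin 3 → ℝ),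
      (∀ x y, pseudoInner ε₁ ε₂ ε₃ (A x) (A y) = pseudoInner ε₁ ε₂ ε₃ x y) ∧
      A e₁ = ![1, 0, 0] ∧ A e₂ = ![0, 1, 0] ∧ A e₃ = ![0, 0, 1] := by
  let M : (Fin 3 → ℝ) →ₗ[ℝ] (Fin 3 → ℝ) :=
    { toFun := fun x => x 0 • e₁ + x 1 • e₂ + x 2 • e₃
      map_add' := fun x y => by simp only [Pi.add_apply]; module
      map_smul' := fun r x => by simp only [Pi.smul_apply, smul_eq_mul, RingHom.id_apply]; module }
  have hM : ∀ x y, pseudoInner ε₁ ε₂ ε₃ (M x) (M y) = pseudoInner ε₁ ε₂ ε₃ x y := he.inner_comb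
  have hinj : Function.Injective M := by
    refine (injective_iff_map_eq_zero M).2 fun x hx => ?_
    have h := fun y => (hM x y).symm
    simp only [hx] at h
    have h0 := h ![1, 0, 0]
    have h1 := h ![0, 1, 0]
    have h2 := h ![0, 0, 1]
    simp [pseudoInner] at h0 h1 h2
    have n1 : ε₁ ≠ 0 := fun h => by simp [h] at hε₁
    have n2 : ε₂ ≠ 0 := fun h => by simp [h] at hε₂
    have n3 : ε₃ ≠ 0 := fun h => by simp [h] at hε₃
    ext i
    fin_cases i
    · exact h0.resolve_left n1
    · exact h1.resolve_left n2
    · exact h2.resolve_left n3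
  let B := LinearEquiv.ofInjectiveEndo M hinj
  have hB : ∀ x, B x = M x := fun x => rfl
  refine ⟨B.symm, fun x y => ?_, ?_, ?_, ?_⟩
  · rw [← hM, ← hB, ← hB, B.apply_symm_apply, B.apply_symm_apply]
  all_goals
    rw [LinearEquiv.symm_apply_eq, hB]
    simp [M]

theorem IsOrthonormalFrame.expansion (hε₁ : ε₁ ^ 2 = 1) (hε₂ : ε₂ ^ 2 = 1)
    (hε₃ : ε₃ ^ 2 = 1) (he : IsOrthonormalFrame ε₁ ε₂ ε₃ e₁ e₂ e₃) (x : Fin 3 → ℝ) :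
    x = (ε₁ * pseudoInner ε₁ ε₂ ε₃ x e₁) • e₁ + (ε₂ * pseudoInner ε₁ ε₂ ε₃ x e₂) • e₂
      + (ε₃ * pseudoInner ε₁ ε₂ ε₃ x e₃) • e₃ := by
  obtain ⟨A, hA, h1, h2, h3⟩ := he.exists_linearEquiv hε₁ hε₂ hε₃
  apply A.injective
  rw [← hA x e₁, ← hA x e₂, ← hA x e₃, map_add, map_add, map_smul, map_smul, map_smul, h1, h2, h3]
  ext i
  fin_cases i
  · simp [pseudoInner]
    linear_combination -(A x 0) * hε₁
  · simp [pseudoInner]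
    linear_combination -(A x 1) * hε₂
  · simp [pseudoInner]
    linear_combination -(A x 2) * hε₃

end Frame

/-! ### Structure equations of an isothermic Dupin surface -/

section StructureEquations

variable {ε₁ ε₂ ε₃ : ℝ} {U : Set (ℝ × ℝ)} {X N : ℝ × ℝ → Fin 3 → ℝ} {b a : ℝ × ℝ → ℝ}

/-- The first frame vector, `-(l₂ - l₁) X₁`. The sign makes it `e₁` at the origin. -/
noncomputable def frame₁ (X : ℝ × ℝ → Fin 3 → ℝ) (b a : ℝ × ℝ → ℝ) (p : ℝ × ℝ) : Fin 3 → ℝ :=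
  -(a p - b p) • partial₁ X p

/-- The second frame vector, `(l₂ - l₁) X₂`. -/
noncomputable def frame₂ (X : ℝ × ℝ → Fin 3 → ℝ) (b a : ℝ × ℝ → ℝ) (p : ℝ × ℝ) : Fin 3 → ℝ :=
  (a p - b p) • partial₂ X p

theorem IsIsothermicDupinSurface.isOrthonormalFrame
    (H : IsIsothermicDupinSurface ε₁ ε₂ ε₃ U X N b a) {p : ℝ × ℝ} (hp : p ∈ U) :
    IsOrthonormalFrame ε₁ ε₂ ε₃ (frame₁ X b a p) (frame₂ X b a p) (N p) := by
  have hf : a p - b p ≠ 0 := sub_ne_zero.2 (H.distinct p hp).symm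
  constructor
  · rw [frame₁, pseudoInner_smul_smul, H.metric₁ p hp]
    field_simp
  · rw [frame₂, pseudoInner_smul_smul, H.metric₂ p hp]
    field_simp
  · exact H.normal_unit p hp
  · rw [frame₁, frame₂, pseudoInner_smul_smul, H.orth p hp, mul_zero]
  · rw [frame₁, pseudoInner_smul_right, H.normal_orth₁ p hp, mul_zero]
  · rw [frame₂, pseudoInner_smul_right, H.normal_orth₂ p hp, mul_zero]

/-- The principal curvatures are smooth because they are quotients such as
`⟨N₁, X₁⟩ / ⟨X₁, X₁⟩`. -/
theorem IsIsothermicDupinSurface.contDiffOn_curvature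
    (H : IsIsothermicDupinSurface ε₁ ε₂ ε₃ U X N b a) (hU : IsOpen U) (hε₁ : ε₁ ^ 2 = 1)
    (hε₂ : ε₂ ^ 2 = 1) : ContDiffOn ℝ ∞ b U ∧ ContDiffOn ℝ ∞ a U := by
  have hf : ∀ p ∈ U, (a p - b p) ^ 2 ≠ 0 := fun p hp =>
    pow_ne_zero 2 (sub_ne_zero.2 (H.distinct p hp).symm)
  have n1 : ε₁ ≠ 0 := fun h => by simp [h] at hε₁
  have n2 : ε₂ ≠ 0 := fun h => by simp [h] at hε₂
  have hX₁ : ContDiffOn ℝ ∞ (partial₁ X) U := H.smooth_param.fderiv_apply_const hU _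
  have hX₂ : ContDiffOn ℝ ∞ (partial₂ X) U := H.smooth_param.fderiv_apply_const hU _
  have hN₁ : ContDiffOn ℝ ∞ (partial₁ N) U := H.smooth_normal.fderiv_apply_const hU _
  have hN₂ : ContDiffOn ℝ ∞ (partial₂ N) U := H.smooth_normal.fderiv_apply_const hU _
  have g₁ : ∀ p ∈ U, pseudoInner ε₁ ε₂ ε₃ (partial₁ X p) (partial₁ X p) ≠ 0 := fun p hp =>
    (H.metric₁ p hp).trans_ne (div_ne_zero n1 (hf p hp))
  have g₂ : ∀ p ∈ U, pseudoInner ε₁ ε₂ ε₃ (partial₂ X p) (partial₂ X p) ≠ 0 := fun p hp =>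
    (H.metric₂ p hp).trans_ne (div_ne_zero n2 (hf p hp))
  constructor
  · refine ((hN₁.pseudoInner hX₁ ε₁ ε₂ ε₃).div (hX₁.pseudoInner hX₁ ε₁ ε₂ ε₃) g₁).congr
      fun p hp => ?_
    rw [Pi.div_apply, H.curvature₁ p hp, pseudoInner_smul_left,
      mul_div_cancel_right₀ _ (g₁ p hp)]
  · refine ((hN₂.pseudoInner hX₂ ε₁ ε₂ ε₃).div (hX₂.pseudoInner hX₂ ε₁ ε₂ ε₃) g₂).congr
      fun p hp => ?_
    rw [Pi.div_apply, H.curvature₂ p hp, pseudoInner_smul_left,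
      mul_div_cancel_right₀ _ (g₂ p hp)]

theorem IsIsothermicDupinSurface.fderiv_curvature
    (H : IsIsothermicDupinSurface ε₁ ε₂ ε₃ U X N b a) (hU : IsOpen U) (hε₁ : ε₁ ^ 2 = 1)
    (hε₂ : ε₂ ^ 2 = 1) {p : ℝ × ℝ} (hp : p ∈ U) :
    fderiv ℝ b p (1, 0) = 0 ∧ fderiv ℝ a p (0, 1) = 0 := by
  obtain ⟨hb, ha⟩ := H.contDiffOn_curvature hU hε₁ hε₂
  have hb' := (hb.differentiableAt_of_isOpen hU hp).lineDeriv_eq_fderiv (v := (1, 0))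
  have ha' := (ha.differentiableAt_of_isOpen hU hp).lineDeriv_eq_fderiv (v := (0, 1))
  rw [← hb', ← ha']
  exact ⟨(H.dupin₁ p hp).lineDeriv, (H.dupin₂ p hp).lineDeriv⟩

theorem fderiv_smul_on {φ : ℝ × ℝ → ℝ} {V : ℝ × ℝ → Fin 3 → ℝ} (hφ : ContDiffOn ℝ ∞ φ U)
    (hV : ContDiffOn ℝ ∞ V U) (hU : IsOpen U) {p : ℝ × ℝ} (hp : p ∈ U) (v : ℝ × ℝ) :
    fderiv ℝ (fun q => φ q • V q) p v = φ p • fderiv ℝ V p v + fderiv ℝ φ p v • V p := by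
  rw [fderiv_fun_smul (hφ.differentiableAt_of_isOpen hU hp) (hV.differentiableAt_of_isOpen hU hp)]
  simp

/-- The derivatives of the frame along the other coordinate, from `N₁₂ = N₂₁` (the Codazzi
equations). -/
theorem IsIsothermicDupinSurface.fderiv_frame_cross
    (H : IsIsothermicDupinSurface ε₁ ε₂ ε₃ U X N b a) (hU : IsOpen U) (hε₁ : ε₁ ^ 2 = 1)
    (hε₂ : ε₂ ^ 2 = 1) {p : ℝ × ℝ} (hp : p ∈ U) :
    fderiv ℝ (frame₁ X b a) p (0, 1)
        = (fderiv ℝ a p (1, 0) / (a p - b p)) • frame₂ X b a p ∧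
      fderiv ℝ (frame₂ X b a) p (1, 0)
        = (-(fderiv ℝ b p (0, 1) / (a p - b p))) • frame₁ X b a p := by
  obtain ⟨hb, ha⟩ := H.contDiffOn_curvature hU hε₁ hε₂
  obtain ⟨hb1, ha2⟩ := H.fderiv_curvature hU hε₁ hε₂ hp
  have hf : a p - b p ≠ 0 := sub_ne_zero.2 (H.distinct p hp).symm
  have hX₁ : ContDiffOn ℝ ∞ (partial₁ X) U := H.smooth_param.fderiv_apply_const hU _
  have hX₂ : ContDiffOn ℝ ∞ (partial₂ X) U := H.smooth_param.fderiv_apply_const hU _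
  have hXs : fderiv ℝ (partial₂ X) p (1, 0) = fderiv ℝ (partial₁ X) p (0, 1) :=
    fderiv_fderiv_comm H.smooth_param hU (0, 1) (1, 0) hp
  have hNs : fderiv ℝ (partial₂ N) p (1, 0) = fderiv ℝ (partial₁ N) p (0, 1) :=
    fderiv_fderiv_comm H.smooth_normal hU (0, 1) (1, 0) hp
  rw [fderiv_congr_on hU H.curvature₁ hp, fderiv_congr_on hU H.curvature₂ hp,
    fderiv_smul_on ha hX₂ hU hp, fderiv_smul_on hb hX₁ hU hp, hXs] at hNs
  have hda := ha.differentiableAt_of_isOpen hU hp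
  have hdb := hb.differentiableAt_of_isOpen hU hp
  have hd : ∀ v, fderiv ℝ (fun q => a q - b q) p v = fderiv ℝ a p v - fderiv ℝ b p v := fun v => by
    rw [fderiv_fun_sub hda hdb]; rfl
  have hd' : ∀ v, fderiv ℝ (fun q => -(a q - b q)) p v = -(fderiv ℝ a p v - fderiv ℝ b p v) :=
    fun v => by rw [fderiv_fun_neg, ← hd]; rfl
  constructor
  · have := fderiv_smul_on (ha.sub hb).neg hX₁ hU hp (0, 1)
    refine this.trans ?_
    rw [hd', ha2, frame₂, smul_smul, div_mul_cancel₀ _ hf]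
    have e : (a p - b p) • fderiv ℝ (partial₁ X) p (0, 1)
        = fderiv ℝ b p (0, 1) • partial₁ X p - fderiv ℝ a p (1, 0) • partial₂ X p := by
      rw [sub_smul]
      linear_combination hNs
    rw [neg_smul, e]
    module
  · have := fderiv_smul_on (ha.sub hb) hX₂ hU hp (1, 0)
    refine this.trans ?_
    rw [hd, hb1, hXs, frame₁, smul_smul, neg_mul_neg, div_mul_cancel₀ _ hf]
    have e : (a p - b p) • fderiv ℝ (partial₁ X) p (0, 1)
        = fderiv ℝ b p (0, 1) • partial₁ X p - fderiv ℝ a p (1, 0) • partial₂ X p := by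
      rw [sub_smul]
      linear_combination hNs
    rw [e]
    module

theorem IsIsothermicDupinSurface.contDiffOn_frame
    (H : IsIsothermicDupinSurface ε₁ ε₂ ε₃ U X N b a) (hU : IsOpen U) (hε₁ : ε₁ ^ 2 = 1)
    (hε₂ : ε₂ ^ 2 = 1) :
    ContDiffOn ℝ ∞ (frame₁ X b a) U ∧ ContDiffOn ℝ ∞ (frame₂ X b a) U := by
  obtain ⟨hb, ha⟩ := H.contDiffOn_curvature hU hε₁ hε₂
  exact ⟨(ha.sub hb).neg.smul (H.smooth_param.fderiv_apply_const hU _),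
    (ha.sub hb).smul (H.smooth_param.fderiv_apply_const hU _)⟩

theorem IsIsothermicDupinSurface.fderiv_param_normal
    (H : IsIsothermicDupinSurface ε₁ ε₂ ε₃ U X N b a) {p : ℝ × ℝ} (hp : p ∈ U) :
    fderiv ℝ X p (1, 0) = (-(1 / (a p - b p))) • frame₁ X b a p ∧
      fderiv ℝ X p (0, 1) = (1 / (a p - b p)) • frame₂ X b a p ∧
      fderiv ℝ N p (1, 0) = (-(b p / (a p - b p))) • frame₁ X b a p ∧
      fderiv ℝ N p (0, 1) = (a p / (a p - b p)) • frame₂ X b a p := by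
  have hf : a p - b p ≠ 0 := sub_ne_zero.2 (H.distinct p hp).symm
  refine ⟨?_, ?_, (H.curvature₁ p hp).trans ?_, (H.curvature₂ p hp).trans ?_⟩
  · rw [frame₁, smul_smul, neg_mul_neg, one_div_mul_cancel hf, one_smul, partial₁]
  · rw [frame₂, smul_smul, one_div_mul_cancel hf, one_smul, partial₂]
  · rw [frame₁, smul_smul, neg_mul_neg, div_mul_cancel₀ _ hf]
  · rw [frame₂, smul_smul, div_mul_cancel₀ _ hf]

theorem inner_fderiv_of_const (hU : IsOpen U) {φ ψ : ℝ × ℝ → Fin 3 → ℝ} (hφ : ContDiffOn ℝ ∞ φ U)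
    (hψ : ContDiffOn ℝ ∞ ψ U) {r : ℝ} (h : ∀ p ∈ U, pseudoInner ε₁ ε₂ ε₃ (φ p) (ψ p) = r)
    {p : ℝ × ℝ} (hp : p ∈ U) (v : ℝ × ℝ) :
    pseudoInner ε₁ ε₂ ε₃ (fderiv ℝ φ p v) (ψ p)
      + pseudoInner ε₁ ε₂ ε₃ (φ p) (fderiv ℝ ψ p v) = 0 := by
  rw [← fderiv_pseudoInner ε₁ ε₂ ε₃ (hφ.differentiableAt_of_isOpen hU hp)
    (hψ.differentiableAt_of_isOpen hU hp), fderiv_eq_zero_of_const hU h hp]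
  rfl

/-- The derivatives of the frame vectors along their own coordinates; their components are
determined by the derivatives of the other frame vectors, since the frame is orthonormal. -/
theorem IsIsothermicDupinSurface.fderiv_frame_self
    (H : IsIsothermicDupinSurface ε₁ ε₂ ε₃ U X N b a) (hU : IsOpen U) (hε₁ : ε₁ ^ 2 = 1)
    (hε₂ : ε₂ ^ 2 = 1) (hε₃ : ε₃ ^ 2 = 1) {p : ℝ × ℝ} (hp : p ∈ U) :
    fderiv ℝ (frame₁ X b a) p (1, 0)
        = (ε₁ * ε₂ * (fderiv ℝ b p (0, 1) / (a p - b p))) • frame₂ X b a p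
          + (ε₁ * ε₃ * (b p / (a p - b p))) • N p ∧
      fderiv ℝ (frame₂ X b a) p (0, 1)
        = (-(ε₁ * ε₂ * (fderiv ℝ a p (1, 0) / (a p - b p)))) • frame₁ X b a p
          + (-(ε₂ * ε₃ * (a p / (a p - b p)))) • N p := by
  obtain ⟨c₁, c₂⟩ := H.contDiffOn_frame hU hε₁ hε₂
  obtain ⟨d₁₂, d₂₁⟩ := H.fderiv_frame_cross hU hε₁ hε₂ hp
  obtain ⟨-, -, dN₁, dN₂⟩ := H.fderiv_param_normal hp
  have he := H.isOrthonormalFrame hp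
  have i₁₁ := inner_fderiv_of_const hU c₁ c₁ (fun p hp => (H.isOrthonormalFrame hp).e₁₁) hp
  have i₂₂ := inner_fderiv_of_const hU c₂ c₂ (fun p hp => (H.isOrthonormalFrame hp).e₂₂) hp
  have i₁₂ := inner_fderiv_of_const hU c₁ c₂ (fun p hp => (H.isOrthonormalFrame hp).e₁₂) hp
  have i₃₁ := inner_fderiv_of_const hU H.smooth_normal c₁
    (fun p hp => (H.isOrthonormalFrame hp).e₃₁) hp
  have i₃₂ := inner_fderiv_of_const hU H.smooth_normal c₂
    (fun p hp => (H.isOrthonormalFrame hp).e₃₂) hp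
  constructor
  · have x₁ := i₁₁ (1, 0)
    rw [pseudoInner_comm ε₁ ε₂ ε₃ (frame₁ X b a p)] at x₁
    have x₂ := i₁₂ (1, 0)
    rw [d₂₁, pseudoInner_smul_right, he.e₁₁] at x₂
    have x₃ := i₃₁ (1, 0)
    rw [dN₁, pseudoInner_smul_left, he.e₁₁, pseudoInner_comm ε₁ ε₂ ε₃ (N p)] at x₃
    rw [he.expansion hε₁ hε₂ hε₃ (fderiv ℝ (frame₁ X b a) p (1, 0)),
      show pseudoInner ε₁ ε₂ ε₃ (fderiv ℝ (frame₁ X b a) p (1, 0)) (frame₁ X b a p) = 0 by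
        linarith, eq_neg_of_add_eq_zero_left x₂, eq_neg_of_add_eq_zero_right x₃]
    module
  · have x₁ := i₁₂ (0, 1)
    rw [d₁₂, pseudoInner_smul_left, he.e₂₂, pseudoInner_comm ε₁ ε₂ ε₃ (frame₁ X b a p)] at x₁
    have x₂ := i₂₂ (0, 1)
    rw [pseudoInner_comm ε₁ ε₂ ε₃ (frame₂ X b a p)] at x₂
    have x₃ := i₃₂ (0, 1)
    rw [dN₂, pseudoInner_smul_left, he.e₂₂, pseudoInner_comm ε₁ ε₂ ε₃ (N p)] at x₃
    rw [he.expansion hε₁ hε₂ hε₃ (fderiv ℝ (frame₂ X b a) p (0, 1)),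
      show pseudoInner ε₁ ε₂ ε₃ (fderiv ℝ (frame₂ X b a) p (0, 1)) (frame₂ X b a p) = 0 by
        linarith, eq_neg_of_add_eq_zero_right x₁, eq_neg_of_add_eq_zero_right x₃]
    module

theorem fderiv_div_apply {f g : ℝ × ℝ → ℝ} {p : ℝ × ℝ} (hg : DifferentiableAt ℝ g p)
    (hf : DifferentiableAt ℝ f p) (h0 : f p ≠ 0) (v : ℝ × ℝ) :
    fderiv ℝ (fun q => g q / f q) p v
      = (f p * fderiv ℝ g p v - g p * fderiv ℝ f p v) / f p ^ 2 := by
  have h := hf.hasFDerivAt.inv_smul_apply hg.hasFDerivAt h0 v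
  simp only [smul_eq_mul] at h
  rw [show (fun q => g q / f q) = fun q => (f q)⁻¹ * g q from funext fun q => by ring, h]
  ring

/-- The Gauss equation, obtained by comparing the two mixed derivatives of the first frame
vector. -/
theorem IsIsothermicDupinSurface.gauss
    (H : IsIsothermicDupinSurface ε₁ ε₂ ε₃ U X N b a) (hU : IsOpen U) (hε₁ : ε₁ ^ 2 = 1)
    (hε₂ : ε₂ ^ 2 = 1) (hε₃ : ε₃ ^ 2 = 1) {p : ℝ × ℝ} (hp : p ∈ U) :
    (a p - b p) * (ε₃ * ε₁ * fderiv ℝ (fun q => fderiv ℝ a q (1, 0)) p (1, 0)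
        - ε₃ * ε₂ * fderiv ℝ (fun q => fderiv ℝ b q (0, 1)) p (0, 1))
      = ε₃ * ε₁ * fderiv ℝ a p (1, 0) ^ 2 + ε₃ * ε₂ * fderiv ℝ b p (0, 1) ^ 2 + a p * b p := by
  obtain ⟨hb, ha⟩ := H.contDiffOn_curvature hU hε₁ hε₂
  obtain ⟨hb1, ha2⟩ := H.fderiv_curvature hU hε₁ hε₂ hp
  obtain ⟨c₁, c₂⟩ := H.contDiffOn_frame hU hε₁ hε₂
  have hf : a p - b p ≠ 0 := sub_ne_zero.2 (H.distinct p hp).symm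
  have he := H.isOrthonormalFrame hp
  have hda := ha.differentiableAt_of_isOpen hU hp
  have hdb := hb.differentiableAt_of_isOpen hU hp
  have hdf : DifferentiableAt ℝ (fun q => a q - b q) p := hda.fun_sub hdb
  have hd : ∀ v, fderiv ℝ (fun q => a q - b q) p v = fderiv ℝ a p v - fderiv ℝ b p v := fun v => by
    rw [fderiv_fun_sub hda hdb]; rfl
  have c₁₁ := c₁.fderiv_apply_const hU (1, 0)
  have c₁₂ := c₁.fderiv_apply_const hU (0, 1)
  have k₁ : ∀ q ∈ U, pseudoInner ε₁ ε₂ ε₃ (fderiv ℝ (frame₁ X b a) q (0, 1)) (frame₂ X b a q)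
      = ε₂ * (fderiv ℝ a q (1, 0) / (a q - b q)) := fun q hq => by
    rw [(H.fderiv_frame_cross hU hε₁ hε₂ hq).1, pseudoInner_smul_left,
      (H.isOrthonormalFrame hq).e₂₂, mul_comm]
  have k₂ : ∀ q ∈ U, pseudoInner ε₁ ε₂ ε₃ (fderiv ℝ (frame₁ X b a) q (1, 0)) (frame₂ X b a q)
      = ε₁ * (fderiv ℝ b q (0, 1) / (a q - b q)) := fun q hq => by
    rw [(H.fderiv_frame_self hU hε₁ hε₂ hε₃ hq).1, pseudoInner_add_left, pseudoInner_smul_left,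
      pseudoInner_smul_left, (H.isOrthonormalFrame hq).e₂₂, (H.isOrthonormalFrame hq).e₃₂]
    linear_combination ε₁ * (fderiv ℝ b q (0, 1) / (a q - b q)) * hε₂
  have e₁ := fderiv_pseudoInner ε₁ ε₂ ε₃ (c₁₂.differentiableAt_of_isOpen hU hp)
    (c₂.differentiableAt_of_isOpen hU hp) (1, 0)
  have e₂ := fderiv_pseudoInner ε₁ ε₂ ε₃ (c₁₁.differentiableAt_of_isOpen hU hp)
    (c₂.differentiableAt_of_isOpen hU hp) (0, 1)
  have da₁ := (ha.fderiv_apply_const hU (1, 0)).differentiableAt_of_isOpen hU hp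
  have db₂ := (hb.fderiv_apply_const hU (0, 1)).differentiableAt_of_isOpen hU hp
  have hfU : ∀ q ∈ U, a q - b q ≠ 0 := fun q hq => sub_ne_zero.2 (H.distinct q hq).symm
  have q₁ : DifferentiableAt ℝ (fun q => fderiv ℝ a q (1, 0) / (a q - b q)) p :=
    ((ha.fderiv_apply_const hU (1, 0)).div (ha.sub hb) hfU).differentiableAt_of_isOpen hU hp
  have q₂ : DifferentiableAt ℝ (fun q => fderiv ℝ b q (0, 1) / (a q - b q)) p :=
    ((hb.fderiv_apply_const hU (0, 1)).div (ha.sub hb) hfU).differentiableAt_of_isOpen hU hp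
  have n₁ := fderiv_const_mul q₁ ε₂
  have n₂ := fderiv_const_mul q₂ ε₁
  have l₁ := fderiv_div_apply da₁ hdf hf (1, 0)
  have l₂ := fderiv_div_apply db₂ hdf hf (0, 1)
  rw [fderiv_congr_on hU k₁ hp, n₁, smul_apply, l₁, hd, hb1] at e₁
  rw [fderiv_congr_on hU k₂ hp, n₂, smul_apply, l₂, hd, ha2] at e₂
  have m := fderiv_fderiv_comm c₁ hU (0, 1) (1, 0) hp
  obtain ⟨d₁₂, d₂₁⟩ := H.fderiv_frame_cross hU hε₁ hε₂ hp
  obtain ⟨d₁₁, d₂₂⟩ := H.fderiv_frame_self hU hε₁ hε₂ hε₃ hp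
  have r₁ : pseudoInner ε₁ ε₂ ε₃ (fderiv ℝ (frame₁ X b a) p (0, 1))
      (fderiv ℝ (frame₂ X b a) p (1, 0)) = 0 := by
    rw [d₁₂, d₂₁, pseudoInner_smul_smul, pseudoInner_comm, he.e₁₂, mul_zero]
  have r₂ : pseudoInner ε₁ ε₂ ε₃ (fderiv ℝ (frame₁ X b a) p (1, 0))
      (fderiv ℝ (frame₂ X b a) p (0, 1)) = -(ε₁ * ε₂ * ε₃ * (a p * b p / (a p - b p) ^ 2)) := by
    have e₂₁ := pseudoInner_comm ε₁ ε₂ ε₃ (frame₂ X b a p) (frame₁ X b a p)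
    have e₂₃ := pseudoInner_comm ε₁ ε₂ ε₃ (frame₂ X b a p) (N p)
    rw [he.e₁₂] at e₂₁
    rw [he.e₃₂] at e₂₃
    rw [d₁₁, d₂₂, pseudoInner_add_left, pseudoInner_comm, pseudoInner_comm ε₁ ε₂ ε₃ (_ • N p),
      pseudoInner_add_left, pseudoInner_add_left]
    simp only [pseudoInner_smul_smul, he.e₁₂, he.e₃₂, he.e₃₃,
      pseudoInner_comm ε₁ ε₂ ε₃ (frame₁ X b a p) (N p), he.e₃₁]
    field_simp
    linear_combination -(ε₁ * ε₂ * ε₃ * a p * b p) * hε₃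
  rw [r₁, m] at e₁
  rw [r₂] at e₂
  have e := congrArg₂ (· - ·) e₁ e₂
  simp only [smul_eq_mul] at e
  field_simp at e
  have hprod : (ε₁ * ε₂ * ε₃) ^ 2 = 1 := by rw [mul_pow, mul_pow, hε₁, hε₂, hε₃]; norm_num
  linear_combination (ε₁ * ε₂ * ε₃) * e
    - ε₃ * ε₁ * ((a p - b p) * fderiv ℝ (fun q => fderiv ℝ a q (1, 0)) p (1, 0)
      - fderiv ℝ a p (1, 0) ^ 2) * hε₂
    + ε₃ * ε₂ * ((a p - b p) * fderiv ℝ (fun q => fderiv ℝ b q (0, 1)) p (0, 1)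
      + fderiv ℝ b p (0, 1) ^ 2) * hε₁ + a p * b p * hprod
end StructureEquations

/-! ### Integration of the Gauss equation -/

section GaussEquation

variable {U : Set (ℝ × ℝ)} {a b : ℝ × ℝ → ℝ}

theorem exists_const_of_partials_eq_zero (hU : IsOpen U) (hUc : IsPreconnected U) {φ : ℝ × ℝ → ℝ}
    (hφ : ContDiffOn ℝ ∞ φ U) (h1 : ∀ p ∈ U, fderiv ℝ φ p (1, 0) = 0)
    (h2 : ∀ p ∈ U, fderiv ℝ φ p (0, 1) = 0) : ∃ r, ∀ p ∈ U, φ p = r := by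
  refine hU.exists_is_const_of_fderiv_eq_zero (𝕜 := ℝ) hUc (hφ.differentiableOn (by simp))
    fun p hp => ?_
  ext
  · simpa using h1 p hp
  · simpa using h2 p hp

/-- The Gauss equation for curvatures with `a₂ = 0` and `b₁ = 0` forces both of them to satisfy
linear equations with constant coefficients. The constant `β` is
`(η₁ a₁₁ + η₂ b₂₂ + b) / (a - b)`, whose partial derivatives vanish because of the differentiated
Gauss equation. -/
theorem exists_linear_equations_of_gauss (hU : IsOpen U) (hUc : IsPreconnected U) {η₁ η₂ : ℝ}
    (ha : ContDiffOn ℝ ∞ a U) (hb : ContDiffOn ℝ ∞ b U) (ha2 : ∀ p ∈ U, fderiv ℝ a p (0, 1) = 0)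
    (hb1 : ∀ p ∈ U, fderiv ℝ b p (1, 0) = 0) (hf : ∀ p ∈ U, a p - b p ≠ 0)
    (hgauss : ∀ p ∈ U, (a p - b p) * (η₁ * fderiv ℝ (fun q => fderiv ℝ a q (1, 0)) p (1, 0)
        - η₂ * fderiv ℝ (fun q => fderiv ℝ b q (0, 1)) p (0, 1))
      = η₁ * fderiv ℝ a p (1, 0) ^ 2 + η₂ * fderiv ℝ b p (0, 1) ^ 2 + a p * b p) :
    ∃ β c : ℝ, ∀ p ∈ U,
      η₁ * fderiv ℝ (fun q => fderiv ℝ a q (1, 0)) p (1, 0) = β * a p + c ∧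
      η₂ * fderiv ℝ (fun q => fderiv ℝ b q (0, 1)) p (0, 1) = -(1 + β) * b p - c ∧
      fderiv ℝ (fun q => fderiv ℝ a q (1, 0)) p (0, 1) = 0 ∧
      fderiv ℝ (fun q => fderiv ℝ b q (0, 1)) p (1, 0) = 0 := by
  have sa₁ := ha.fderiv_apply_const hU (1, 0)
  have sb₂ := hb.fderiv_apply_const hU (0, 1)
  set a₁ : ℝ × ℝ → ℝ := fun q => fderiv ℝ a q (1, 0) with ha₁
  set b₂ : ℝ × ℝ → ℝ := fun q => fderiv ℝ b q (0, 1) with hb₂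
  have sa₁₁ := sa₁.fderiv_apply_const hU (1, 0)
  have sb₂₂ := sb₂.fderiv_apply_const hU (0, 1)
  have ma : ∀ p ∈ U, fderiv ℝ a₁ p (0, 1) = 0 := fun p hp => by
    rw [ha₁, fderiv_fderiv_comm ha hU _ _ hp, fderiv_eq_zero_of_const hU ha2 hp]
    rfl
  have mb : ∀ p ∈ U, fderiv ℝ b₂ p (1, 0) = 0 := fun p hp => by
    rw [hb₂, fderiv_fderiv_comm hb hU _ _ hp, fderiv_eq_zero_of_const hU hb1 hp]
    rfl
  set a₁₁ : ℝ × ℝ → ℝ := fun q => fderiv ℝ a₁ q (1, 0) with ha₁₁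
  set b₂₂ : ℝ × ℝ → ℝ := fun q => fderiv ℝ b₂ q (0, 1) with hb₂₂
  have maa : ∀ p ∈ U, fderiv ℝ a₁₁ p (0, 1) = 0 := fun p hp => by
    rw [ha₁₁, fderiv_fderiv_comm sa₁ hU _ _ hp, fderiv_eq_zero_of_const hU ma hp]
    rfl
  have mbb : ∀ p ∈ U, fderiv ℝ b₂₂ p (1, 0) = 0 := fun p hp => by
    rw [hb₂₂, fderiv_fderiv_comm sb₂ hU _ _ hp, fderiv_eq_zero_of_const hU mb hp]
    rfl
  -- the differentiated Gauss equation
  have dgauss : ∀ p ∈ U, ∀ v, (fderiv ℝ a p v - fderiv ℝ b p v) * (η₁ * a₁₁ p - η₂ * b₂₂ p)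
      + (a p - b p) * (η₁ * fderiv ℝ a₁₁ p v - η₂ * fderiv ℝ b₂₂ p v)
      = 2 * η₁ * a₁ p * fderiv ℝ a₁ p v + 2 * η₂ * b₂ p * fderiv ℝ b₂ p v
        + fderiv ℝ a p v * b p + a p * fderiv ℝ b p v := by
    intro p hp v
    have da := (ha.differentiableAt_of_isOpen hU hp).hasFDerivAt
    have db := (hb.differentiableAt_of_isOpen hU hp).hasFDerivAt
    have da₁ := (sa₁.differentiableAt_of_isOpen hU hp).hasFDerivAt
    have db₂ := (sb₂.differentiableAt_of_isOpen hU hp).hasFDerivAt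
    have da₁₁ := (sa₁₁.differentiableAt_of_isOpen hU hp).hasFDerivAt
    have db₂₂ := (sb₂₂.differentiableAt_of_isOpen hU hp).hasFDerivAt
    have l := (da.fun_sub db).fun_mul ((da₁₁.const_mul η₁).fun_sub (db₂₂.const_mul η₂))
    have r := (((da₁.fun_mul da₁).const_mul η₁).fun_add
      ((db₂.fun_mul db₂).const_mul η₂)).fun_add (da.fun_mul db)
    have e := fderiv_congr_on hU (φ := fun q => (a q - b q) * (η₁ * a₁₁ q - η₂ * b₂₂ q))
      (ψ := fun q => η₁ * (a₁ q * a₁ q) + η₂ * (b₂ q * b₂ q) + a q * b q)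
      (fun q hq => by rw [hgauss q hq]; ring) hp
    rw [l.fderiv, r.fderiv] at e
    have ev := congrArg (fun L => L v) e
    simp only [add_apply, sub_apply, smul_apply, smul_eq_mul] at ev
    linear_combination ev
  obtain ⟨β, hβ⟩ : ∃ β, ∀ p ∈ U, (η₁ * a₁₁ p + η₂ * b₂₂ p + b p) / (a p - b p) = β := by
    have hd : ∀ p ∈ U, ∀ v, fderiv ℝ
        (fun q => (η₁ * a₁₁ q + η₂ * b₂₂ q + b q) / (a q - b q)) p v
        = ((a p - b p) * (η₁ * fderiv ℝ a₁₁ p v + η₂ * fderiv ℝ b₂₂ p v + fderiv ℝ b p v)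
          - (η₁ * a₁₁ p + η₂ * b₂₂ p + b p) * (fderiv ℝ a p v - fderiv ℝ b p v))
          / (a p - b p) ^ 2 := by
      intro p hp v
      have da := (ha.differentiableAt_of_isOpen hU hp).hasFDerivAt
      have db := (hb.differentiableAt_of_isOpen hU hp).hasFDerivAt
      have da₁₁ := (sa₁₁.differentiableAt_of_isOpen hU hp).hasFDerivAt
      have db₂₂ := (sb₂₂.differentiableAt_of_isOpen hU hp).hasFDerivAt
      have n := ((da₁₁.const_mul η₁).fun_add (db₂₂.const_mul η₂)).fun_add db
      have d := da.fun_sub db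
      refine (fderiv_div_apply n.differentiableAt d.differentiableAt (hf p hp) v).trans ?_
      rw [n.fderiv, d.fderiv]
      simp only [add_apply, sub_apply, smul_apply, smul_eq_mul]
    refine exists_const_of_partials_eq_zero hU hUc
      ((((contDiffOn_const.mul sa₁₁).add (contDiffOn_const.mul sb₂₂)).add hb).div (ha.sub hb) hf)
      (fun p hp => (hd p hp _).trans ?_) (fun p hp => (hd p hp _).trans ?_)
    · have := dgauss p hp (1, 0)
      rw [hb1 p hp, mb p hp, mbb p hp] at this
      rw [hb1 p hp, mbb p hp]
      refine div_eq_zero_iff.2 (Or.inl ?_)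
      linear_combination this
    · have := dgauss p hp (0, 1)
      rw [ha2 p hp, ma p hp, maa p hp] at this
      rw [ha2 p hp, maa p hp]
      refine div_eq_zero_iff.2 (Or.inl ?_)
      linear_combination -this
  have hβ' : ∀ p ∈ U, η₁ * a₁₁ p + η₂ * b₂₂ p + b p = β * (a p - b p) := fun p hp => by
    rw [← hβ p hp, div_mul_cancel₀ _ (hf p hp)]
  obtain ⟨c, hc⟩ : ∃ c, ∀ p ∈ U, η₁ * a₁₁ p - β * a p = c := by
    have hd : ∀ p ∈ U, ∀ v, fderiv ℝ (fun q => η₁ * a₁₁ q - β * a q) p v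
        = η₁ * fderiv ℝ a₁₁ p v - β * fderiv ℝ a p v := by
      intro p hp v
      have da := (ha.differentiableAt_of_isOpen hU hp).hasFDerivAt
      have da₁₁ := (sa₁₁.differentiableAt_of_isOpen hU hp).hasFDerivAt
      rw [((da₁₁.const_mul η₁).fun_sub (da.const_mul β)).fderiv]
      simp only [sub_apply, smul_apply, smul_eq_mul]
    refine exists_const_of_partials_eq_zero hU hUc
      ((contDiffOn_const.mul sa₁₁).sub (contDiffOn_const.mul ha))
      (fun p hp => (hd p hp _).trans ?_) (fun p hp => (hd p hp _).trans ?_)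
    · have := dgauss p hp (1, 0)
      rw [hb1 p hp, mb p hp, mbb p hp] at this
      refine (mul_eq_zero.1 ?_).resolve_left (hf p hp)
      linear_combination this + fderiv ℝ a p (1, 0) * hβ' p hp
    · rw [ha2 p hp, maa p hp]
      ring
  refine ⟨β, c, fun p hp => ⟨?_, ?_, ma p hp, mb p hp⟩⟩
  · linear_combination hc p hp
  · linear_combination hβ' p hp - hc p hp

/-- On a connected domain the curvatures are functions of one coordinate each, given by solutions
of the linear equations on the whole line. -/
theorem eqOn_of_linear_equations (hU : IsOpen U) (hUc : IsPreconnected U)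
    (h0 : ((0, 0) : ℝ × ℝ) ∈ U) {κ v μ w : ℝ} (ha : ContDiffOn ℝ ∞ a U) (hb : ContDiffOn ℝ ∞ b U)
    (ha2 : ∀ p ∈ U, fderiv ℝ a p (0, 1) = 0) (hb1 : ∀ p ∈ U, fderiv ℝ b p (1, 0) = 0)
    (ha12 : ∀ p ∈ U, fderiv ℝ (fun q => fderiv ℝ a q (1, 0)) p (0, 1) = 0)
    (hb21 : ∀ p ∈ U, fderiv ℝ (fun q => fderiv ℝ b q (0, 1)) p (1, 0) = 0)
    (ha11 : ∀ p ∈ U, fderiv ℝ (fun q => fderiv ℝ a q (1, 0)) p (1, 0) = κ * a p + v)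
    (hb22 : ∀ p ∈ U, fderiv ℝ (fun q => fderiv ℝ b q (0, 1)) p (0, 1) = μ * b p + w)
    {h₁ h₁' h₂ h₂' : ℝ → ℝ} (s₁ : IsSolution κ v h₁ h₁') (s₂ : IsSolution μ w h₂ h₂')
    (i₁ : h₁ 0 = a (0, 0)) (i₁' : h₁' 0 = fderiv ℝ a (0, 0) (1, 0)) (i₂ : h₂ 0 = b (0, 0))
    (i₂' : h₂' 0 = fderiv ℝ b (0, 0) (0, 1)) : ∀ p ∈ U, b p = h₂ p.2 ∧ a p = h₁ p.1 := by
  have sa₁ := ha.fderiv_apply_const hU (1, 0)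
  have sb₂ := hb.fderiv_apply_const hU (0, 1)
  have d : ∀ p ∈ U, ∀ i : Fin 4, HasFDerivAt
      ((![fun q => a q - h₁ q.1, fun q => fderiv ℝ a q (1, 0) - h₁' q.1, fun q => b q - h₂ q.2,
        fun q => fderiv ℝ b q (0, 1) - h₂' q.2] : Fin 4 → ℝ × ℝ → ℝ) i)
      ((![fderiv ℝ a p - (ContinuousLinearMap.fst ℝ ℝ ℝ).smulRight (h₁' p.1),
        fderiv ℝ (fun q => fderiv ℝ a q (1, 0)) p
          - (ContinuousLinearMap.fst ℝ ℝ ℝ).smulRight (κ • h₁ p.1 + v),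
        fderiv ℝ b p - (ContinuousLinearMap.snd ℝ ℝ ℝ).smulRight (h₂' p.2),
        fderiv ℝ (fun q => fderiv ℝ b q (0, 1)) p
          - (ContinuousLinearMap.snd ℝ ℝ ℝ).smulRight (μ • h₂ p.2 + w)] :
        Fin 4 → ℝ × ℝ →L[ℝ] ℝ) i) p := by
    intro p hp i
    fin_cases i
    · exact (ha.differentiableAt_of_isOpen hU hp).hasFDerivAt.fun_sub
        (s₁.hasDerivAt p.1).comp_fst_prod
    · exact (sa₁.differentiableAt_of_isOpen hU hp).hasFDerivAt.fun_sub
        (s₁.hasDerivAt' p.1).comp_fst_prod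
    · exact (hb.differentiableAt_of_isOpen hU hp).hasFDerivAt.fun_sub
        (s₂.hasDerivAt p.2).comp_snd_prod
    · exact (sb₂.differentiableAt_of_isOpen hU hp).hasFDerivAt.fun_sub
        (s₂.hasDerivAt' p.2).comp_snd_prod
  have key := eq_zero_of_linear_system hU hUc
    (P := fun _ => ![![0, 1, 0, 0], ![κ, 0, 0, 0], ![0, 0, 0, 0], ![0, 0, 0, 0]])
    (Q := fun _ => ![![0, 0, 0, 0], ![0, 0, 0, 0], ![0, 0, 0, 1], ![0, 0, μ, 0]])
    (fun i p hp => (d p hp i).differentiableAt) continuousOn_const continuousOn_const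
    (fun i p hp => by
      rw [(d p hp i).fderiv, Fin.sum_univ_four]
      fin_cases i <;> simp [hb1 p hp, ha11 p hp, hb21 p hp]
      ring)
    (fun i p hp => by
      rw [(d p hp i).fderiv, Fin.sum_univ_four]
      fin_cases i <;> simp [ha2 p hp, hb22 p hp, ha12 p hp]
      ring) h0
    (fun i => by
      fin_cases i <;> simp [i₁, i₁', i₂, i₂'])
  exact fun p hp => ⟨sub_eq_zero.1 (key p hp 2), sub_eq_zero.1 (key p hp 0)⟩

end GaussEquation

/-- The principal curvatures of an `ε`-isothermic Dupin surface. -/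
theorem IsIsothermicDupinSurface.exists_isCurvaturePair {ε₁ ε₂ ε₃ : ℝ} {U : Set (ℝ × ℝ)}
    {X N : ℝ × ℝ → Fin 3 → ℝ} {b a : ℝ × ℝ → ℝ}
    (H : IsIsothermicDupinSurface ε₁ ε₂ ε₃ U X N b a) (hU : IsOpen U) (hUc : IsPreconnected U)
    (h0 : ((0, 0) : ℝ × ℝ) ∈ U) (hε₁ : ε₁ ^ 2 = 1) (hε₂ : ε₂ ^ 2 = 1) (hε₃ : ε₃ ^ 2 = 1) :
    ∃ β c h₁ h₁' h₂ h₂', IsCurvaturePair (ε₃ * ε₁) (ε₃ * ε₂) β c h₁ h₁' h₂ h₂' ∧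
      ∀ p ∈ U, b p = h₂ p.2 ∧ a p = h₁ p.1 := by
  obtain ⟨hb, ha⟩ := H.contDiffOn_curvature hU hε₁ hε₂
  have hd := fun p hp => H.fderiv_curvature hU hε₁ hε₂ (p := p) hp
  have hη₁ : (ε₃ * ε₁) ^ 2 = 1 := by rw [mul_pow, hε₁, hε₃, one_mul]
  have hη₂ : (ε₃ * ε₂) ^ 2 = 1 := by rw [mul_pow, hε₂, hε₃, one_mul]
  obtain ⟨β, c, hβ⟩ := exists_linear_equations_of_gauss hU hUc ha hb (fun p hp => (hd p hp).2)
    (fun p hp => (hd p hp).1) (fun p hp => sub_ne_zero.2 (H.distinct p hp).symm)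
    (fun p hp => H.gauss hU hε₁ hε₂ hε₃ hp)
  obtain ⟨h₁, h₁', s₁, i₁, i₁'⟩ := exists_isSolution (ε₃ * ε₁ * β) (ε₃ * ε₁ * c) (a (0, 0))
    (fderiv ℝ a (0, 0) (1, 0))
  obtain ⟨h₂, h₂', s₂, i₂, i₂'⟩ := exists_isSolution (ε₃ * ε₂ * -(1 + β)) (-(ε₃ * ε₂ * c))
    (b (0, 0)) (fderiv ℝ b (0, 0) (0, 1))
  refine ⟨β, c, h₁, h₁', h₂, h₂', ⟨s₁, s₂, ?_⟩, ?_⟩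
  · have g := H.gauss hU hε₁ hε₂ hε₃ h0
    rw [(hβ _ h0).1, (hβ _ h0).2.1] at g
    rw [i₁, i₁', i₂, i₂']
    linear_combination g
  · refine eqOn_of_linear_equations hU hUc h0 ha hb (fun p hp => (hd p hp).2)
      (fun p hp => (hd p hp).1) (fun p hp => (hβ p hp).2.2.1) (fun p hp => (hβ p hp).2.2.2)
      (fun p hp => ?_) (fun p hp => ?_) s₁ s₂ i₁ i₁' i₂ i₂'
    · linear_combination ε₃ * ε₁ * (hβ p hp).1
        - fderiv ℝ (fun q => fderiv ℝ a q (1, 0)) p (1, 0) * hη₁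
    · linear_combination ε₃ * ε₂ * (hβ p hp).2.1
        - fderiv ℝ (fun q => fderiv ℝ b q (0, 1)) p (0, 1) * hη₂

/-! ### Rigidity and the proof of the theorem -/

section Rigidity

variable {ε₁ ε₂ ε₃ : ℝ} {U : Set (ℝ × ℝ)} {X N : ℝ × ℝ → Fin 3 → ℝ} {b a : ℝ × ℝ → ℝ}

/-- The position vector of a surface, followed by its orthonormal frame. -/
noncomputable def movingFrame (X N : ℝ × ℝ → Fin 3 → ℝ) (b a : ℝ × ℝ → ℝ) :
    Fin 4 → ℝ × ℝ → Fin 3 → ℝ :=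
  ![X, frame₁ X b a, frame₂ X b a, N]

/-- The coefficients of the structure equations in the first coordinate direction. -/
noncomputable def connection₁ (ε₁ ε₂ ε₃ : ℝ) (b a : ℝ × ℝ → ℝ) (p : ℝ × ℝ) : Fin 4 → Fin 4 → ℝ :=
  ![![0, -(1 / (a p - b p)), 0, 0],
    ![0, 0, ε₁ * ε₂ * (fderiv ℝ b p (0, 1) / (a p - b p)), ε₁ * ε₃ * (b p / (a p - b p))],
    ![0, -(fderiv ℝ b p (0, 1) / (a p - b p)), 0, 0],
    ![0, -(b p / (a p - b p)), 0, 0]]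

/-- The coefficients of the structure equations in the second coordinate direction. -/
noncomputable def connection₂ (ε₁ ε₂ ε₃ : ℝ) (b a : ℝ × ℝ → ℝ) (p : ℝ × ℝ) : Fin 4 → Fin 4 → ℝ :=
  ![![0, 0, 1 / (a p - b p), 0],
    ![0, 0, fderiv ℝ a p (1, 0) / (a p - b p), 0],
    ![0, -(ε₁ * ε₂ * (fderiv ℝ a p (1, 0) / (a p - b p))), 0, -(ε₂ * ε₃ * (a p / (a p - b p)))],
    ![0, 0, a p / (a p - b p), 0]]

theorem IsIsothermicDupinSurface.continuousOn_connection
    (H : IsIsothermicDupinSurface ε₁ ε₂ ε₃ U X N b a) (hU : IsOpen U) (hε₁ : ε₁ ^ 2 = 1)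
    (hε₂ : ε₂ ^ 2 = 1) :
    ContinuousOn (connection₁ ε₁ ε₂ ε₃ b a) U ∧ ContinuousOn (connection₂ ε₁ ε₂ ε₃ b a) U := by
  obtain ⟨hb, ha⟩ := H.contDiffOn_curvature hU hε₁ hε₂
  have ca := ha.continuousOn
  have cb := hb.continuousOn
  have ca₁ := (ha.fderiv_apply_const hU (1, 0)).continuousOn
  have cb₂ := (hb.fderiv_apply_const hU (0, 1)).continuousOn
  have hf : ∀ p ∈ U, a p - b p ≠ 0 := fun p hp => sub_ne_zero.2 (H.distinct p hp).symm
  have q : ∀ {g : ℝ × ℝ → ℝ}, ContinuousOn g U → ContinuousOn (fun p => g p / (a p - b p)) U :=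
    fun hg => hg.div (ca.sub cb) hf
  have c1 : ContinuousOn (fun p => 1 / (a p - b p)) U := q continuousOn_const
  constructor <;> refine continuousOn_pi.2 fun i => continuousOn_pi.2 fun j => ?_
  · fin_cases i <;> fin_cases j <;> first
      | exact continuousOn_const
      | exact c1.neg
      | exact continuousOn_const.mul (q cb₂)
      | exact continuousOn_const.mul (q cb)
      | exact (q cb₂).neg
      | exact (q cb).neg
  · fin_cases i <;> fin_cases j <;> first
      | exact continuousOn_const
      | exact c1
      | exact q ca₁
      | exact (continuousOn_const.mul (q ca₁)).neg
      | exact (continuousOn_const.mul (q ca)).neg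
      | exact q ca

theorem IsIsothermicDupinSurface.differentiableAt_movingFrame
    (H : IsIsothermicDupinSurface ε₁ ε₂ ε₃ U X N b a) (hU : IsOpen U) (hε₁ : ε₁ ^ 2 = 1)
    (hε₂ : ε₂ ^ 2 = 1) (i : Fin 4) {p : ℝ × ℝ} (hp : p ∈ U) :
    DifferentiableAt ℝ (movingFrame X N b a i) p := by
  obtain ⟨c₁, c₂⟩ := H.contDiffOn_frame hU hε₁ hε₂
  fin_cases i
  · exact H.smooth_param.differentiableAt_of_isOpen hU hp
  · exact c₁.differentiableAt_of_isOpen hU hp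
  · exact c₂.differentiableAt_of_isOpen hU hp
  · exact H.smooth_normal.differentiableAt_of_isOpen hU hp

theorem IsIsothermicDupinSurface.fderiv_movingFrame
    (H : IsIsothermicDupinSurface ε₁ ε₂ ε₃ U X N b a) (hU : IsOpen U) (hε₁ : ε₁ ^ 2 = 1)
    (hε₂ : ε₂ ^ 2 = 1) (hε₃ : ε₃ ^ 2 = 1) (i : Fin 4) {p : ℝ × ℝ} (hp : p ∈ U) :
    fderiv ℝ (movingFrame X N b a i) p (1, 0)
        = ∑ j, connection₁ ε₁ ε₂ ε₃ b a p i j • movingFrame X N b a j p ∧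
      fderiv ℝ (movingFrame X N b a i) p (0, 1)
        = ∑ j, connection₂ ε₁ ε₂ ε₃ b a p i j • movingFrame X N b a j p := by
  obtain ⟨dX₁, dX₂, dN₁, dN₂⟩ := H.fderiv_param_normal hp
  obtain ⟨d₁₂, d₂₁⟩ := H.fderiv_frame_cross hU hε₁ hε₂ hp
  obtain ⟨d₁₁, d₂₂⟩ := H.fderiv_frame_self hU hε₁ hε₂ hε₃ hp
  rw [Fin.sum_univ_four, Fin.sum_univ_four]
  fin_cases i <;>
    simp [movingFrame, connection₁, connection₂, dX₁, dX₂, dN₁, dN₂, d₁₁, d₁₂, d₂₁, d₂₂]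

/-- A surface of the given kind is determined by its principal curvatures and, up to an isometry,
by its frame at one point. -/
theorem IsIsothermicDupinSurface.eqOn_of_movingFrame_eq {X' N' : ℝ × ℝ → Fin 3 → ℝ}
    (H : IsIsothermicDupinSurface ε₁ ε₂ ε₃ U X N b a)
    (H' : IsIsothermicDupinSurface ε₁ ε₂ ε₃ U X' N' b a) (hU : IsOpen U)
    (hUc : IsPreconnected U) (hε₁ : ε₁ ^ 2 = 1) (hε₂ : ε₂ ^ 2 = 1) (hε₃ : ε₃ ^ 2 = 1)
    {p₀ : ℝ × ℝ} (hp₀ : p₀ ∈ U) (A : (Fin 3 → ℝ) →L[ℝ] (Fin 3 → ℝ)) (w : Fin 3 → ℝ)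
    (hX : A (X p₀) + w = X' p₀) (h₁ : A (frame₁ X b a p₀) = frame₁ X' b a p₀)
    (h₂ : A (frame₂ X b a p₀) = frame₂ X' b a p₀) (hN : A (N p₀) = N' p₀) :
    ∀ p ∈ U, A (X p) + w = X' p := by
  -- the translation enters the position vector only, which has coefficient zero in the system
  let t : Fin 4 → Fin 3 → ℝ := ![w, 0, 0, 0]
  have hd : ∀ i, ∀ p ∈ U, HasFDerivAt
      (fun p => A (movingFrame X N b a i p) + t i - movingFrame X' N' b a i p)
      (A.comp (fderiv ℝ (movingFrame X N b a i) p) - fderiv ℝ (movingFrame X' N' b a i) p) p :=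
    fun i p hp => ((A.hasFDerivAt.comp p
      (H.differentiableAt_movingFrame hU hε₁ hε₂ i hp).hasFDerivAt).add_const (t i)).fun_sub
      (H'.differentiableAt_movingFrame hU hε₁ hε₂ i hp).hasFDerivAt
  have hcol₁ : ∀ p i j, connection₁ ε₁ ε₂ ε₃ b a p i j • t j = 0 := fun p i j => by
    fin_cases j <;> fin_cases i <;> simp [connection₁, t]
  have hcol₂ : ∀ p i j, connection₂ ε₁ ε₂ ε₃ b a p i j • t j = 0 := fun p i j => by
    fin_cases j <;> fin_cases i <;> simp [connection₂, t]
  obtain ⟨k₁, k₂⟩ := H.continuousOn_connection hU hε₁ hε₂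
  have key := eq_zero_of_linear_system hU hUc
    (Y := fun i p => A (movingFrame X N b a i p) + t i - movingFrame X' N' b a i p)
    (fun i p hp => (hd i p hp).differentiableAt) k₁ k₂
    (fun i p hp => by
      rw [(hd i p hp).fderiv]
      simp only [sub_apply, ContinuousLinearMap.comp_apply,
        (H.fderiv_movingFrame hU hε₁ hε₂ hε₃ i hp).1, (H'.fderiv_movingFrame hU hε₁ hε₂ hε₃ i hp).1,
        map_sum, map_smul, smul_sub, smul_add, hcol₁, add_zero, Finset.sum_sub_distrib])
    (fun i p hp => by
      rw [(hd i p hp).fderiv]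
      simp only [sub_apply, ContinuousLinearMap.comp_apply,
        (H.fderiv_movingFrame hU hε₁ hε₂ hε₃ i hp).2, (H'.fderiv_movingFrame hU hε₁ hε₂ hε₃ i hp).2,
        map_sum, map_smul, smul_sub, smul_add, hcol₂, add_zero, Finset.sum_sub_distrib])
    hp₀
    (fun i => by
      fin_cases i
      · exact sub_eq_zero.2 hX
      · exact sub_eq_zero.2 ((add_zero _).trans h₁)
      · exact sub_eq_zero.2 ((add_zero _).trans h₂)
      · exact sub_eq_zero.2 ((add_zero _).trans hN))
  exact fun p hp => sub_eq_zero.1 (key p hp 0)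

theorem IsIsothermicDupinSurface.congr_curvature {b' a' : ℝ × ℝ → ℝ}
    (H : IsIsothermicDupinSurface ε₁ ε₂ ε₃ U X N b a) (hU : IsOpen U)
    (h : ∀ p ∈ U, b p = b' p ∧ a p = a' p) : IsIsothermicDupinSurface ε₁ ε₂ ε₃ U X N b' a' where
  toIsCurvatureLineSurface :=
    { H.toIsCurvatureLineSurface with
      curvature₁ := fun p hp => (h p hp).1 ▸ H.curvature₁ p hp
      curvature₂ := fun p hp => (h p hp).2 ▸ H.curvature₂ p hp
      distinct := fun p hp => (h p hp).1 ▸ (h p hp).2 ▸ H.distinct p hp }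
  dupin₁ p hp := (H.dupin₁ p hp).congr_of_eventuallyEq
    (Filter.mem_of_superset (hU.mem_nhds hp) fun q hq => (h q hq).1.symm)
  dupin₂ p hp := (H.dupin₂ p hp).congr_of_eventuallyEq
    (Filter.mem_of_superset (hU.mem_nhds hp) fun q hq => (h q hq).2.symm)
  metric₁ p hp := (h p hp).1 ▸ (h p hp).2 ▸ H.metric₁ p hp
  metric₂ p hp := (h p hp).1 ▸ (h p hp).2 ▸ H.metric₂ p hp

end Rigidity

theorem exists_isGeneratingPair (η₁ η₂ b₁ b₂ : ℝ) (h₁ h₂ : ℝ → ℝ) :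
    ∃ G₁ G₂, IsGeneratingPair η₁ η₂ b₁ b₂ h₁ h₂ G₁ G₂ := by
  have key : ∀ (κ : ℝ) (v x y : Fin 3 → ℝ), ∃ G, SolvesIVP κ v x y G := by
    intro κ v x y
    obtain ⟨G, G', hG, h0, h0'⟩ := exists_isSolution_pi κ v x y
    have hd : deriv G = G' := funext fun u => (hG.hasDerivAt u).deriv
    refine ⟨G, contDiff_infty.1 hG.contDiff.1 2, fun u => ?_, h0, by rw [hd, h0']⟩
    rw [hd, (hG.hasDerivAt' u).deriv, add_sub_cancel_left]
  obtain ⟨G₁, hG₁⟩ := key (η₁ * b₁) (vecOne η₁ η₂ b₁ h₁ h₂) ![0, 0, 1] ![1, 0, 0]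
  obtain ⟨G₂, hG₂⟩ := key (η₂ * b₂) (vecTwo η₁ η₂ b₁ h₁ h₂) ![0, 0, 1] ![0, 1, 0]
  exact ⟨G₁, G₂, hG₁, hG₂⟩

theorem initial_frame_dupinParam {η₁ η₂ b₁ b₂ : ℝ} {h₁ h₁' h₂ h₂' : ℝ → ℝ} {G₁ G₂ : ℝ → Fin 3 → ℝ}
    (dh₁ : HasDerivAt h₁ (h₁' 0) 0) (dh₂ : HasDerivAt h₂ (h₂' 0) 0)
    (hG : IsGeneratingPair η₁ η₂ b₁ b₂ h₁ h₂ G₁ G₂) (hf : h₁ 0 - h₂ 0 ≠ 0) :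
    dupinParam h₁ h₂ G₁ G₂ (0, 0) = 0 ∧
      frame₁ (dupinParam h₁ h₂ G₁ G₂) (fun p => h₂ p.2) (fun p => h₁ p.1) (0, 0) = ![1, 0, 0] ∧
      frame₂ (dupinParam h₁ h₂ G₁ G₂) (fun p => h₂ p.2) (fun p => h₁ p.1) (0, 0) = ![0, 1, 0] ∧
      dupinNormal h₁ h₂ G₁ G₂ (0, 0) = ![0, 0, 1] := by
  obtain ⟨e₁, e₂⟩ := fderiv_dupinParam (p := (0, 0)) dh₁ dh₂ (hG.1.isSolution.hasDerivAt 0)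
    (hG.2.isSolution.hasDerivAt 0) hf
  simp only [hG.1.init, hG.2.init, hG.1.init_deriv, hG.2.init_deriv, sub_self, smul_zero,
    add_zero] at e₁ e₂
  refine ⟨by simp [dupinParam, hG.1.init, hG.2.init], ?_, ?_, ?_⟩
  · rw [frame₁, e₁]
    ext i
    simp only [Pi.smul_apply, Pi.neg_apply, smul_eq_mul]
    field_simp
  · rw [frame₂, e₂]
    ext i
    simp only [Pi.smul_apply, smul_eq_mul]
    field_simp
  · simp only [dupinNormal, hG.1.init, hG.2.init]
    rw [← sub_smul, smul_smul, inv_mul_cancel₀ hf, one_smul]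

theorem theorem5 (ε₁ ε₂ ε₃ : ℝ) (hε₁ : ε₁ ^ 2 = 1) (hε₂ : ε₂ ^ 2 = 1) (hε₃ : ε₃ ^ 2 = 1)
    (U : Set (ℝ × ℝ)) (hU : IsOpen U) (hUc : IsConnected U) (h0 : (0, 0) ∈ U) :
    (∀ (X N : ℝ × ℝ → Fin 3 → ℝ) (l₁ l₂ : ℝ × ℝ → ℝ),
      IsIsothermicDupinSurface ε₁ ε₂ ε₃ U X N l₁ l₂ →
      ((¬ ∃ c, ∀ p ∈ U, l₁ p = c) ∨ (¬ ∃ c, ∀ p ∈ U, l₂ p = c)) →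
      ∃ (b₁ b₂ : ℝ) (h₁ h₂ : ℝ → ℝ) (G₁ G₂ : ℝ → Fin 3 → ℝ)
        (A : (Fin 3 → ℝ) ≃ₗ[ℝ] (Fin 3 → ℝ)) (w : Fin 3 → ℝ),
        IsCurvatureFamily (ε₃ * ε₁) (ε₃ * ε₂) b₁ b₂ h₁ h₂ ∧
        (∀ p ∈ U, l₁ p = h₂ p.2 ∧ l₂ p = h₁ p.1) ∧
        IsGeneratingPair (ε₃ * ε₁) (ε₃ * ε₂) b₁ b₂ h₁ h₂ G₁ G₂ ∧
        (∀ x y, pseudoInner ε₁ ε₂ ε₃ (A x) (A y) = pseudoInner ε₁ ε₂ ε₃ x y) ∧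
        A (X (0, 0)) + w = 0 ∧
        A (partial₁ X (0, 0)) = (h₁ 0 - h₂ 0)⁻¹ • ![-1, 0, 0] ∧
        A (partial₂ X (0, 0)) = (h₁ 0 - h₂ 0)⁻¹ • ![0, 1, 0] ∧
        A (N (0, 0)) = ![0, 0, 1] ∧
        ∀ p ∈ U, A (X p) + w = dupinParam h₁ h₂ G₁ G₂ p) ∧
    (∀ (b₁ b₂ : ℝ) (h₁ h₂ : ℝ → ℝ) (G₁ G₂ : ℝ → Fin 3 → ℝ),
      IsCurvatureFamily (ε₃ * ε₁) (ε₃ * ε₂) b₁ b₂ h₁ h₂ →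
      (∀ p ∈ U, h₁ p.1 ≠ h₂ p.2) →
      IsGeneratingPair (ε₃ * ε₁) (ε₃ * ε₂) b₁ b₂ h₁ h₂ G₁ G₂ →
      ∃ N : ℝ × ℝ → Fin 3 → ℝ,
        IsIsothermicDupinSurface ε₁ ε₂ ε₃ U (dupinParam h₁ h₂ G₁ G₂) N
          (fun p => h₂ p.2) (fun p => h₁ p.1)) := by
  have hη₁ : (ε₃ * ε₁) ^ 2 = 1 := by rw [mul_pow, hε₁, hε₃, one_mul]
  have hη₂ : (ε₃ * ε₂) ^ 2 = 1 := by rw [mul_pow, hε₂, hε₃, one_mul]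
  refine ⟨fun X N l₁ l₂ H _ => ?_, fun b₁ b₂ h₁ h₂ G₁ G₂ hh hne hG => ?_⟩
  · obtain ⟨β, c, h₁, h₁', h₂, h₂', hp, hl⟩ :=
      H.exists_isCurvaturePair hU hUc.isPreconnected h0 hε₁ hε₂ hε₃
    obtain ⟨G₁, G₂, hG⟩ :=
      exists_isGeneratingPair (ε₃ * ε₁) (ε₃ * ε₂) β (-(1 + β)) h₁ h₂
    have H₁ := H.congr_curvature (b' := fun p => h₂ p.2) (a' := fun p => h₁ p.1) hU hl
    have hne : ∀ p ∈ U, h₁ p.1 ≠ h₂ p.2 := fun p hp => (H₁.distinct p hp).symm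
    have hf : h₁ 0 - h₂ 0 ≠ 0 := sub_ne_zero.2 (hne _ h0)
    have H₂ := isIsothermicDupinSurface_dupinParam hε₁ hε₂ hε₃ h0 hp hne hG
    obtain ⟨i₀, i₁, i₂, i₃⟩ :=
      initial_frame_dupinParam (hp.sol₁.hasDerivAt 0) (hp.sol₂.hasDerivAt 0) hG hf
    obtain ⟨A, hA, a₁, a₂, a₃⟩ := (H₁.isOrthonormalFrame h0).exists_linearEquiv hε₁ hε₂ hε₃
    refine ⟨β, -(1 + β), h₁, h₂, G₁, G₂, A, -A (X (0, 0)), hp.isCurvatureFamily hη₁ hη₂, hl, hG, hA,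
      add_neg_cancel _, ?_, ?_, a₃, ?_⟩
    · have := (H₁.fderiv_param_normal h0).1
      rw [partial₁, this, map_smul, a₁]
      simp
    · have := (H₁.fderiv_param_normal h0).2.1
      rw [partial₂, this, map_smul, a₂]
      simp
    · exact H₁.eqOn_of_movingFrame_eq H₂ hU hUc.isPreconnected hε₁ hε₂ hε₃ h0
        (LinearMap.toContinuousLinearMap (A : (Fin 3 → ℝ) →ₗ[ℝ] (Fin 3 → ℝ))) _
        (by simp [i₀]) (by simp [a₁, i₁]) (by simp [a₂, i₂]) (by simp [a₃, i₃])
  · obtain ⟨c, h₁', h₂', hp⟩ := hh.exists_isCurvaturePair hη₁ hη₂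
    obtain rfl := hh.1
    exact ⟨_, isIsothermicDupinSurface_dupinParam hε₁ hε₂ hε₃ h0 hp hne hG⟩
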